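/- Let $\beta>1$ be a Pisot unit of degree $d$, i.e. a real algebraic integer $\beta>1$ whose other Galois conjugates $\beta_2,\dots,\beta_d$ satisfy $|\beta_j|<1$ and whose minimal polynomial has constant term $\pm1$; put $\beta_1=\beta$, and let $\Gamma_j:\mathbb{Q}(\beta)\to\mathbb{Q}(\beta_j)$ be the isomorphism with $\Gamma_j(\beta)=\beta_j$. Let $\mathbf v_j=\nu_j(\beta_j^{d-1},\dots,\beta_j,1)^t$ with $\nu_j\in\mathbb{C}$ such that $\mathbf v_1+\dots+\mathbf v_d=(1,0,\dots,0)^t$, let $H\subset\mathbb{R}^d$ be the hyperplane spanned by the real and imaginary parts of $\mathbf v_2,\dots,\mathbf v_d$, let $\pi_1:\mathbb{R}^d\to\mathbb{R}$ be given by $\pi_1(t\mathbf v_1+\mathbf y)=t$ for $\mathbf y\in H$, and let $\Phi:\mathbb{Q}(\beta)\to H$, $\Phi(x)=\sum_{j=2}^d\Gamma_j(x)\mathbf v_j$. Let $T:X\to X$ be a right-continuous $\beta$-transformation with digits in $\mathbb{Z}[\beta]$: $A\subset\mathbb{Z}[\beta]$ is a finite non-empty set, $X\subset\mathbb{R}$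 is the disjoint union of non-empty sets $X_a$, $a\in A$, each $X_a$ is a finite union of intervals $[\ell_i,r_i)$, $i\in I_a$, $\bigcup_{a\in A}(\beta X_a-a)=X$, and $Tx=\beta x-a$ for $x\in X_a$. Let $\widetilde X_a=\bigcup_{i\in I_a}(\ell_i,r_i]$, $\widetilde X=\bigcup_{a\in A}\widetilde X_a$, and $\widetilde Tx=\beta x-a$ for $x\in\widetilde X_a$. For $x\in X$ let $b(x)=b_1(x)b_2(x)\cdots$ be the sequence with $b_k(x)=a$ if $T^{k-1}x\in X_a$; the sequences $b(x)$, $x\in X$, are called admissible. Let $\mathcal S$ be the set of $u=(u_k)_{k\in\mathbb{Z}}\in A^{\mathbb{Z}}$ such that $u_ku_{k+1}\cdots$ is admissible for all $k\in\mathbb{Z}$. For a sequence $w=(w_k)_{k\le0}$ in $A$ put $\varphi(w)=\sum_{k\le0}\Phi(w_k\beta^{-k})$, and for $u\in\mathcal S$ put $\psi(u)=\big(\sum_{k\ge1}u_k\beta^{-k}\big)\mathbf v_1-\varphi((u_k)_{k\le0})$. Let $\widehat X=\psi(\mathcal S)$ and let $\mu$ be the measure $\mu(E)=\lambda^d(\widehat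 X\cap\pi_1^{-1}(E))$, where $\lambda^d$ is the Lebesgue measure on $\mathbb{R}^d$. For $x\in X$ let $$\mathcal D_x=\{\varphi((u_k)_{k\le0}):\ u\in\mathcal S,\ u_1u_2\cdots=b(x)\}\subset H.$$ For $x\in X\cap\widetilde X$ let $m_x\in\{1,2,\dots\}\cup\{\infty\}$ be the least $k\ge1$ with $\widetilde T^kx=T^kx$ ($\infty$ if there is none), and let $$\mathcal V=(X\setminus\widetilde X)\cup\bigcup_{x\in X\cap\widetilde X}\ \bigcup_{1\le k<m_x}\{T^kx,\widetilde T^kx\}\cap X .$$ Assume that the support of $\mu$ is $X$ (that is, up to closure: the closed support of $\mu$ in $\mathbb{R}$ is the closure of $X$) and that $\mathcal V$ is finite. Then the family of tiles $\mathcal T_x=\Phi(x)+\mathcal D_x$, $x\in\mathbb{Z}[\beta]\cap X$, is a multiple tiling of $H$, that is: 1. there are only finitely many different sets $\mathcal D_x$, $x\in\mathbb{Z}[\beta]\cap X$, and these sets are compact; 2. for every $\mathbf y\in H$ there is an $r>0$ such that $\mathcal T_x\cap B(\mathbf y,r)\ne\emptyset$ for only finitely many $x\in\mathbb{Z}[\beta]\cap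 X$; 3. every $\mathbf y\in H$ lies in some $\mathcal T_x$, $x\in\mathbb{Z}[\beta]\cap X$; 4. every $\mathcal D_x$, $x\in\mathbb{Z}[\beta]\cap X$, is the closure of its interior in $H$; 5. there is an integer $m\ge1$ such that, for almost every $\mathbf y\in H$ with respect to the $(d-1)$-dimensional Lebesgue measure, there are exactly $m$ elements $x\in\mathbb{Z}[\beta]\cap X$ with $\mathbf y\in\mathcal T_x$. -/

import Mathlib

open scoped IntermediateField

namespace BetaTiling

noncomputable section

/-! ### Pisot units, the field `ℚ(β)` and its embeddings -/

/-- `β` is a Pisot unit: a real algebraic integer `> 1` all of whose other Galois conjugates have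
modulus `< 1`, and whose minimal polynomial has constant coefficient `± 1`. -/
class IsPisotUnit (β : ℝ) : Prop where
  one_lt : 1 < β
  isIntegral : IsIntegral ℤ β
  norm_conj_lt_one : ∀ z : ℂ, Polynomial.aeval z (minpoly ℚ β) = 0 → z ≠ (β : ℂ) → ‖z‖ < 1
  abs_coeff_zero : |(minpoly ℚ β).coeff 0| = 1

/-- The degree `d` of `β`. -/
def deg (β : ℝ) : ℕ := (minpoly ℚ β).natDegree

/-- `β` as an element of the field `ℚ(β)`. -/
def gen (β : ℝ) : ℚ⟮β⟯ := IntermediateField.AdjoinSimple.gen ℚ β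

/-- The elements of the ring `ℤ[β]`, inside `ℚ(β)`. -/
def ringZ (β : ℝ) : Subalgebra ℤ ℚ⟮β⟯ := Algebra.adjoin ℤ {gen β}

theorem isIntegral_rat (β : ℝ) [h : IsPisotUnit β] : IsIntegral ℚ β :=
  h.isIntegral.tower_top

instance finiteDimensional (β : ℝ) [IsPisotUnit β] : FiniteDimensional ℚ ℚ⟮β⟯ :=
  IntermediateField.adjoin.finiteDimensional (isIntegral_rat β)

/-- The inclusion `ℚ(β) → ℝ → ℂ`, i.e. the embedding belonging to the conjugate `β₁ = β`. The
other conjugates `β_j = σ β` belong to the other embeddings `σ`; then `σ` is `Γ_j`. -/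
def emb₁ (β : ℝ) : ℚ⟮β⟯ →ₐ[ℚ] ℂ :=
  (Complex.ofRealAm.restrictScalars ℚ).comp ℚ⟮β⟯.val

/-! ### The eigenvectors `v_j`, the contracting hyperplane, and the map `Φ` -/

/-- The Euclidean space `ℝ^d`, where `d` is the degree of `β`. -/
abbrev Space (β : ℝ) : Type := EuclideanSpace ℝ (Fin (deg β))

/-- The normalizing constant `ν_j`; see `sum_eigvec` for the property that determines it. -/
def nu (β : ℝ) (σ : ℚ⟮β⟯ →ₐ[ℚ] ℂ) : ℂ :=
  (Polynomial.aeval (σ (gen β)) (Polynomial.derivative (minpoly ℚ β)))⁻¹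

/-- The eigenvector `v_j = ν_j (β_j^(d-1), …, β_j, 1)` of the companion matrix of `β`. -/
def eigvec (β : ℝ) (σ : ℚ⟮β⟯ →ₐ[ℚ] ℂ) (i : Fin (deg β)) : ℂ :=
  nu β σ * σ (gen β) ^ (deg β - 1 - (i : ℕ))

/-- The real part of `v_j`. -/
def reVec (β : ℝ) (σ : ℚ⟮β⟯ →ₐ[ℚ] ℂ) : Space β := WithLp.toLp 2 fun i => (eigvec β σ i).re

/-- The imaginary part of `v_j`. -/
def imVec (β : ℝ) (σ : ℚ⟮β⟯ →ₐ[ℚ] ℂ) : Space β := WithLp.toLp 2 fun i => (eigvec β σ i).im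

/-- The vector `v_1`, which is real. -/
def vec₁ (β : ℝ) : Space β := reVec β (emb₁ β)

/-- The contracting hyperplane `H` of `ℝ^d`, spanned by the real and imaginary parts of
`v_2, …, v_d`. -/
def hyperplane (β : ℝ) : Submodule ℝ (Space β) :=
  Submodule.span ℝ (reVec β '' {σ | σ ≠ emb₁ β} ∪ imVec β '' {σ | σ ≠ emb₁ β})

open scoped Classical in
/-- `∑_{j ≥ 2} Γ_j(x) v_j` as a vector of `ℝ^d`. The sum is real, see `phiVec_ofReal`. -/
def phiVec (β : ℝ) [IsPisotUnit β] (x : ℚ⟮β⟯) : Space β :=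
  WithLp.toLp 2 fun i => (∑ σ : ℚ⟮β⟯ →ₐ[ℚ] ℂ with σ ≠ emb₁ β, σ x * eigvec β σ i).re

theorem phiVec_mem (β : ℝ) [IsPisotUnit β] (x : ℚ⟮β⟯) : phiVec β x ∈ hyperplane β := by
  classical
  have h : phiVec β x = ∑ σ : ℚ⟮β⟯ →ₐ[ℚ] ℂ with σ ≠ emb₁ β,
      ((σ x).re • reVec β σ - (σ x).im • imVec β σ) := by
    ext i
    simp [phiVec, reVec, imVec, Complex.re_sum, Complex.mul_re]
  rw [h]
  refine Submodule.sum_mem _ fun σ hσ => ?_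
  have hσ' : σ ≠ emb₁ β := (Finset.mem_filter.mp hσ).2
  exact Submodule.sub_mem _
    (Submodule.smul_mem _ _ (Submodule.subset_span (Or.inl ⟨σ, hσ', rfl⟩)))
    (Submodule.smul_mem _ _ (Submodule.subset_span (Or.inr ⟨σ, hσ', rfl⟩)))

/-- The map `Φ : ℚ(β) → H`, `Φ(x) = ∑_{j ≥ 2} Γ_j(x) v_j`. -/
def Phi (β : ℝ) [IsPisotUnit β] (x : ℚ⟮β⟯) : hyperplane β := ⟨phiVec β x, phiVec_mem β x⟩

/-- The coordinate `π₁` along `v_1` in the decomposition `ℝ^d = ℝ v_1 ⊕ H`, written with the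
coefficients of `f(X) / (X - β)`, where `f` is the minimal polynomial of `β`. The defining
property is proved in `proj₁_smul_add` and `exists_decomp`. -/
def proj₁ (β : ℝ) (y : Space β) : ℝ :=
  ∑ i : Fin (deg β), (((minpolyDiv ℚ (gen β)).coeff (deg β - 1 - (i : ℕ)) : ℚ⟮β⟯) : ℝ) * y i

/-! ### Facts that justify these definitions -/

theorem minpoly_gen (β : ℝ) : minpoly ℚ (gen β) = minpoly ℚ β :=
  IntermediateField.minpoly_gen ℚ β

theorem eigvec_eq (β : ℝ) (σ : ℚ⟮β⟯ →ₐ[ℚ] ℂ) (i : Fin (deg β)) :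
    eigvec β σ i = σ (gen β ^ (deg β - 1 - (i : ℕ)) /
      Polynomial.aeval (gen β) (Polynomial.derivative (minpoly ℚ (gen β)))) := by
  rw [eigvec, nu, map_div₀, map_pow, ← Polynomial.aeval_algHom_apply, minpoly_gen,
    div_eq_inv_mul]

theorem adjoin_gen (β : ℝ) [IsPisotUnit β] : Algebra.adjoin ℚ {gen β} = ⊤ := by
  have h := (IntermediateField.adjoin.powerBasis (isIntegral_rat β)).adjoin_gen_eq_top
  rwa [IntermediateField.adjoin.powerBasis_gen] at h

theorem finrank_eq (β : ℝ) [IsPisotUnit β] : Module.finrank ℚ ℚ⟮β⟯ = deg β :=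
  IntermediateField.adjoin.finrank (isIntegral_rat β)

theorem deg_pos (β : ℝ) [IsPisotUnit β] : 0 < deg β :=
  minpoly.natDegree_pos (isIntegral_rat β)

theorem sum_eigvec_mul (β : ℝ) [IsPisotUnit β] (i : Fin (deg β)) (j : ℕ) :
    ∑ σ : ℚ⟮β⟯ →ₐ[ℚ] ℂ, eigvec β σ i * σ ((minpolyDiv ℚ (gen β)).coeff j) =
      if j = deg β - 1 - (i : ℕ) then 1 else 0 := by
  have hr : deg β - 1 - (i : ℕ) < Module.finrank ℚ ℚ⟮β⟯ := by
    rw [finrank_eq]; have := deg_pos β; omega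
  have h := congrArg (fun p : Polynomial ℂ => p.coeff j)
    (sum_smul_minpolyDiv_eq_X_pow ℂ (adjoin_gen β) hr)
  simpa [Polynomial.finsetSum_coeff, Polynomial.coeff_X_pow, eigvec_eq] using h

/-- `v_1 + ⋯ + v_d = e_1`, which determines the constants `ν_j`. -/
theorem sum_eigvec (β : ℝ) [IsPisotUnit β] (i : Fin (deg β)) :
    ∑ σ : ℚ⟮β⟯ →ₐ[ℚ] ℂ, eigvec β σ i = if (i : ℕ) = 0 then 1 else 0 := by
  have h := sum_eigvec_mul β i (deg β - 1)
  have hi : IsIntegral ℚ (gen β) := Algebra.IsIntegral.isIntegral _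
  have hm : (minpolyDiv ℚ (gen β)).coeff (deg β - 1) = 1 := by
    have h1 := minpolyDiv_monic hi
    rwa [Polynomial.Monic, Polynomial.leadingCoeff, natDegree_minpolyDiv, minpoly_gen] at h1
  rw [hm] at h
  simp only [map_one, mul_one] at h
  rw [h]
  have := deg_pos β
  have := i.2
  congr 1
  apply propext
  omega

/-- The sum that defines `Φ(x)` is real. -/
theorem phiVec_ofReal (β : ℝ) [IsPisotUnit β] (x : ℚ⟮β⟯) (i : Fin (deg β)) :
    open scoped Classical in
    ((phiVec β x i : ℝ) : ℂ) =
      ∑ σ : ℚ⟮β⟯ →ₐ[ℚ] ℂ with σ ≠ emb₁ β, σ x * eigvec β σ i := by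
  classical
  simp only [phiVec]
  rw [← Complex.conj_eq_iff_re, map_sum]
  let c : ℂ →ₐ[ℚ] ℂ := Complex.conjAe.toAlgHom.restrictScalars ℚ
  have hc : ∀ z, c z = (starRingEnd ℂ) z := fun z => rfl
  have hcc : ∀ σ : ℚ⟮β⟯ →ₐ[ℚ] ℂ, c.comp (c.comp σ) = σ := by
    intro σ; ext; simp [hc]
  have hc1 : c.comp (emb₁ β) = emb₁ β := by
    ext y; exact Complex.conj_ofReal _
  refine Finset.sum_bij' (fun σ _ => c.comp σ) (fun σ _ => c.comp σ) ?_ ?_ ?_ ?_ ?_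
  · intro σ hσ
    simp only [Finset.mem_filter, Finset.mem_univ, true_and] at hσ ⊢
    intro h
    apply hσ
    rw [← hcc σ, h, hc1]
  · intro σ hσ
    simp only [Finset.mem_filter, Finset.mem_univ, true_and] at hσ ⊢
    intro h
    apply hσ
    rw [← hcc σ, h, hc1]
  · intro σ _; exact hcc σ
  · intro σ _; exact hcc σ
  · intro σ _
    rw [map_mul, eigvec_eq, eigvec_eq]
    rfl

theorem proj₁_add (β : ℝ) (y z : Space β) : proj₁ β (y + z) = proj₁ β y + proj₁ β z := by
  simp [proj₁, mul_add, Finset.sum_add_distrib]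

theorem proj₁_smul (β : ℝ) (t : ℝ) (y : Space β) : proj₁ β (t • y) = t * proj₁ β y := by
  simp only [proj₁, Finset.mul_sum]
  refine Finset.sum_congr rfl fun i _ => ?_
  simp; ring

theorem sum_mul_eigvec (β : ℝ) [IsPisotUnit β] (σ : ℚ⟮β⟯ →ₐ[ℚ] ℂ) :
    open scoped Classical in
    ∑ i : Fin (deg β), ((((minpolyDiv ℚ (gen β)).coeff (deg β - 1 - (i : ℕ)) : ℚ⟮β⟯) : ℝ) : ℂ) *
      eigvec β σ i = if σ = emb₁ β then 1 else 0 := by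
  classical
  have hi : IsIntegral ℚ (gen β) := Algebra.IsIntegral.isIntegral _
  have hinj : Function.Injective (fun σ : ℚ⟮β⟯ →ₐ[ℚ] ℂ => σ (gen β)) := fun _ _ h =>
    AlgHom.ext_of_adjoin_eq_top (adjoin_gen β) (fun _ hx => hx ▸ h)
  have h1 := eval₂_minpolyDiv_self (R := ℚ) (gen β) (emb₁ β) σ
  have hdeg : (minpolyDiv ℚ (gen β)).natDegree < deg β := by
    rw [natDegree_minpolyDiv, minpoly_gen]
    exact Nat.sub_lt (deg_pos β) one_pos
  rw [Polynomial.eval₂_eq_sum_range' _ hdeg] at h1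
  have h2 : ∑ i : Fin (deg β), ((((minpolyDiv ℚ (gen β)).coeff (deg β - 1 - (i : ℕ)) :
      ℚ⟮β⟯) : ℝ) : ℂ) * eigvec β σ i = nu β σ * ∑ i ∈ Finset.range (deg β),
        (emb₁ β) ((minpolyDiv ℚ (gen β)).coeff i) * σ (gen β) ^ i := by
    rw [← Finset.sum_range_reflect, Finset.mul_sum, ← Fin.sum_univ_eq_sum_range
      (fun j => nu β σ * ((emb₁ β) ((minpolyDiv ℚ (gen β)).coeff (deg β - 1 - j)) *
        σ (gen β) ^ (deg β - 1 - j)))]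
    refine Finset.sum_congr rfl fun i _ => ?_
    rw [eigvec]
    have : ((((minpolyDiv ℚ (gen β)).coeff (deg β - 1 - (i : ℕ)) : ℚ⟮β⟯) : ℝ) : ℂ) =
      (emb₁ β) ((minpolyDiv ℚ (gen β)).coeff (deg β - 1 - (i : ℕ))) := rfl
    rw [this]; ring
  rw [h2]
  have h3 : (∑ i ∈ Finset.range (deg β),
        (emb₁ β) ((minpolyDiv ℚ (gen β)).coeff i) * σ (gen β) ^ i) = _ := h1
  rw [h3]
  by_cases hσ : σ = emb₁ β
  · subst hσ
    rw [if_pos rfl, if_pos rfl, nu, ← minpoly_gen, Polynomial.aeval_algHom_apply]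
    apply inv_mul_cancel₀
    rw [ne_eq, map_eq_zero]
    exact (Algebra.IsSeparable.isSeparable ℚ (gen β)).aeval_derivative_ne_zero
      (minpoly.aeval _ _)
  · rw [if_neg hσ, if_neg fun h => hσ (hinj h).symm, mul_zero]

theorem proj₁_reVec (β : ℝ) [IsPisotUnit β] (σ : ℚ⟮β⟯ →ₐ[ℚ] ℂ) :
    open scoped Classical in proj₁ β (reVec β σ) = if σ = emb₁ β then 1 else 0 := by
  classical
  have h := congrArg Complex.re (sum_mul_eigvec β σ)
  rw [Complex.re_sum] at h
  simp only [Complex.re_ofReal_mul] at h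
  simp only [proj₁, reVec]
  rw [h]
  split_ifs <;> simp

theorem proj₁_imVec (β : ℝ) [IsPisotUnit β] (σ : ℚ⟮β⟯ →ₐ[ℚ] ℂ) :
    proj₁ β (imVec β σ) = 0 := by
  classical
  have h := congrArg Complex.im (sum_mul_eigvec β σ)
  rw [Complex.im_sum] at h
  simp only [Complex.im_ofReal_mul] at h
  simp only [proj₁, imVec]
  rw [h]
  split_ifs <;> simp

/-- `π₁(t v_1 + y) = t` for `y ∈ H`. -/
theorem proj₁_smul_add (β : ℝ) [IsPisotUnit β] (t : ℝ) (y : Space β) (hy : y ∈ hyperplane β) :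
    proj₁ β (t • vec₁ β + y) = t := by
  have h0 : proj₁ β y = 0 := by
    induction hy using Submodule.span_induction with
    | mem x hx =>
      rcases hx with ⟨σ, hσ, rfl⟩ | ⟨σ, hσ, rfl⟩
      · rw [proj₁_reVec, if_neg hσ]
      · exact proj₁_imVec β σ
    | zero => simp [proj₁]
    | add x y _ _ hx hy => rw [proj₁_add, hx, hy, add_zero]
    | smul a x _ hx => rw [proj₁_smul, hx, mul_zero]
  rw [proj₁_add, proj₁_smul, h0, vec₁, proj₁_reVec, if_pos rfl, mul_one, add_zero]

/-- Every vector of `ℝ^d` is `t v_1 + y` with `y ∈ H`, so that `H` is indeed a hyperplane. -/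
theorem exists_decomp (β : ℝ) [IsPisotUnit β] (x : Space β) :
    ∃ y ∈ hyperplane β, x = proj₁ β x • vec₁ β + y := by
  classical
  refine ⟨∑ j : Fin (deg β), x j • phiVec β ((minpolyDiv ℚ (gen β)).coeff (deg β - 1 - (j : ℕ))),
    Submodule.sum_mem _ fun j _ => Submodule.smul_mem _ _ (phiVec_mem β _), ?_⟩
  ext i
  have key : ∀ j : Fin (deg β),
      (((minpolyDiv ℚ (gen β)).coeff (deg β - 1 - (j : ℕ)) : ℚ⟮β⟯) : ℝ) * vec₁ β i +
        phiVec β ((minpolyDiv ℚ (gen β)).coeff (deg β - 1 - (j : ℕ))) i =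
      if j = i then 1 else 0 := by
    intro j
    have h := congrArg Complex.re (sum_eigvec_mul β i (deg β - 1 - (j : ℕ)))
    rw [← Finset.add_sum_erase _ _ (Finset.mem_univ (emb₁ β)), Complex.add_re] at h
    have e1 : (eigvec β (emb₁ β) i *
        (emb₁ β) ((minpolyDiv ℚ (gen β)).coeff (deg β - 1 - (j : ℕ)))).re =
        (((minpolyDiv ℚ (gen β)).coeff (deg β - 1 - (j : ℕ)) : ℚ⟮β⟯) : ℝ) * vec₁ β i := by
      rw [mul_comm]
      exact Complex.re_ofReal_mul _ _
    have e2 : (Finset.univ.erase (emb₁ β)) =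
        ({σ | σ ≠ emb₁ β} : Finset (ℚ⟮β⟯ →ₐ[ℚ] ℂ)) := by
      ext; simp
    rw [e1, e2] at h
    have e3 : phiVec β ((minpolyDiv ℚ (gen β)).coeff (deg β - 1 - (j : ℕ))) i =
        (∑ σ : ℚ⟮β⟯ →ₐ[ℚ] ℂ with σ ≠ emb₁ β,
          eigvec β σ i * σ ((minpolyDiv ℚ (gen β)).coeff (deg β - 1 - (j : ℕ)))).re := by
      simp only [phiVec]
      congr 1
      exact Finset.sum_congr (by ext; simp) fun σ _ => mul_comm _ _
    rw [e3, h]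
    have : (deg β - 1 - (j : ℕ) = deg β - 1 - (i : ℕ)) ↔ j = i := by
      rw [Fin.ext_iff]; omega
    simp only [this]
    split_ifs <;> simp
  have : (∑ j : Fin (deg β), x j * ((((minpolyDiv ℚ (gen β)).coeff (deg β - 1 - (j : ℕ)) :
      ℚ⟮β⟯) : ℝ) * vec₁ β i +
        phiVec β ((minpolyDiv ℚ (gen β)).coeff (deg β - 1 - (j : ℕ))) i)) = x i := by
    simp [key]
  simp only [PiLp.add_apply, PiLp.smul_apply, smul_eq_mul, WithLp.ofLp_sum, Finset.sum_apply]
  rw [← this, proj₁, Finset.sum_mul, ← Finset.sum_add_distrib]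
  refine Finset.sum_congr rfl fun j _ => ?_
  simp; ring

/-! ### Right-continuous `β`-transformations -/

/-- A finite union of left-closed right-open intervals `[ℓ, r)`. -/
def icoUnion (s : Finset (ℝ × ℝ)) : Set ℝ := ⋃ p ∈ s, Set.Ico p.1 p.2

/-- The corresponding union of the left-open right-closed intervals `(ℓ, r]`. -/
def iocUnion (s : Finset (ℝ × ℝ)) : Set ℝ := ⋃ p ∈ s, Set.Ioc p.1 p.2

/-- The data of a right-continuous `β`-transformation with digits in `ℚ(β)`: a finite non-empty set
`A` of digits and, for every digit `a`, finitely many intervals with union `X_a`. The sets `X_a` are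
non-empty and pairwise disjoint, and `⋃ (β X_a - a) = ⋃ X_a`. -/
structure Transf (β : ℝ) where
  A : Finset ℚ⟮β⟯
  intervals : ℚ⟮β⟯ → Finset (ℝ × ℝ)
  A_nonempty : A.Nonempty
  piece_nonempty : ∀ a ∈ A, (icoUnion (intervals a)).Nonempty
  piece_disjoint : ∀ a ∈ A, ∀ a' ∈ A, a ≠ a' →
    Disjoint (icoUnion (intervals a)) (icoUnion (intervals a'))
  image_eq : ⋃ a ∈ A, (fun x : ℝ => β * x - (a : ℝ)) '' icoUnion (intervals a) =
    ⋃ a ∈ A, icoUnion (intervals a)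

namespace Transf

variable {β : ℝ} (T : Transf β)

/-- The set `X_a`. -/
def piece (a : ℚ⟮β⟯) : Set ℝ := icoUnion (T.intervals a)

/-- The domain `X`. -/
def domain : Set ℝ := ⋃ a ∈ T.A, T.piece a

/-- The set `X̃_a`. -/
def pieceL (a : ℚ⟮β⟯) : Set ℝ := iocUnion (T.intervals a)

/-- The domain `X̃` of the left-continuous transformation. -/
def domainL : Set ℝ := ⋃ a ∈ T.A, T.pieceL a

open scoped Classical in
/-- The first digit of `x`: the `a ∈ A` with `x ∈ X_a` (and `0` outside of `X`). -/
def digit (x : ℝ) : ℚ⟮β⟯ := if h : ∃ a ∈ T.A, x ∈ T.piece a then h.choose else 0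

open scoped Classical in
/-- The `a ∈ A` with `x ∈ X̃_a` (and `0` outside of `X̃`). -/
def digitL (x : ℝ) : ℚ⟮β⟯ := if h : ∃ a ∈ T.A, x ∈ T.pieceL a then h.choose else 0

/-- The right-continuous transformation, `T x = β x - a` for `x ∈ X_a`; only its values on `X`
matter. -/
def map (x : ℝ) : ℝ := β * x - (T.digit x : ℝ)

/-- The left-continuous transformation `T̃ x = β x - a` for `x ∈ X̃_a`; only its values on `X̃`
matter. -/
def mapL (x : ℝ) : ℝ := β * x - (T.digitL x : ℝ)

/-- The expansion `b(x)`: the entry with index `n` is the digit `b_{n+1}(x)`. -/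
def expansion (x : ℝ) (n : ℕ) : ℚ⟮β⟯ := T.digit (T.map^[n] x)

/-- Admissible sequences: the expansions of the points of `X`. -/
def Admissible (v : ℕ → ℚ⟮β⟯) : Prop := ∃ x ∈ T.domain, v = T.expansion x

/-- The set `𝒮` of two-sided sequences of digits all of whose right-infinite truncations are
admissible. -/
def twoSided : Set (ℤ → ℚ⟮β⟯) :=
  {u | (∀ k, u k ∈ T.A) ∧ ∀ k : ℤ, T.Admissible fun n : ℕ => u (k + n)}

/-- The number `m_x`: the least `k ≥ 1` with `T̃^k x = T^k x`, or `∞`. -/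
def meetingTime (x : ℝ) : ℕ∞ :=
  sInf {m : ℕ∞ | ∃ k : ℕ, m = k ∧ 1 ≤ k ∧ T.mapL^[k] x = T.map^[k] x}

/-- The set `𝒱`. -/
def V : Set ℝ :=
  (T.domain \ T.domainL) ∪
    ⋃ x ∈ T.domain ∩ T.domainL, ⋃ k ∈ {k : ℕ | 1 ≤ k ∧ (k : ℕ∞) < T.meetingTime x},
      {T.map^[k] x, T.mapL^[k] x} ∩ T.domain

end Transf

/-! ### The natural extension domain, the invariant measure and the tiles -/

/-- The value `∑_{k ≥ 1} v_k β^(-k)` of a right-infinite sequence; `v_k` is the entry `k - 1`. -/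
def value (β : ℝ) (v : ℕ → ℚ⟮β⟯) : ℝ := ∑' n : ℕ, (v n : ℝ) / β ^ (n + 1)

/-- `φ(w) = ∑_{k ≤ 0} Φ(w_k β^(-k))` for a left-infinite sequence; `w_k` is the entry `-k`. -/
def phiSeq (β : ℝ) [IsPisotUnit β] (w : ℕ → ℚ⟮β⟯) : hyperplane β :=
  ∑' n : ℕ, Phi β (w n * gen β ^ n)

/-- `ψ(u) = (∑_{k ≥ 1} u_k β^(-k)) v_1 - φ(… u_{-1} u_0)`. -/
def psi (β : ℝ) [IsPisotUnit β] (u : ℤ → ℚ⟮β⟯) : Space β :=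
  value β (fun n : ℕ => u (n + 1)) • vec₁ β - (phiSeq β (fun n : ℕ => u (-n)) : Space β)

namespace Transf

variable {β : ℝ} [IsPisotUnit β] (T : Transf β)

/-- The natural extension domain `X̂ = ψ(𝒮)`. -/
def natExt : Set (Space β) := psi β '' T.twoSided

/-- The invariant measure `μ(E) = λ^d {x ∈ X̂ : π₁(x) ∈ E}`. -/
def invMeasure : MeasureTheory.Measure ℝ :=
  (MeasureTheory.volume.restrict T.natExt).map (proj₁ β)

/-- The set `𝒟_x = {φ(w) : w · b(x) ∈ 𝒮}`. -/
def prototile (x : ℝ) : Set (hyperplane β) :=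
  {y | ∃ u ∈ T.twoSided, (∀ n : ℕ, u (n + 1) = T.expansion x n) ∧
    y = phiSeq β (fun n : ℕ => u (-n))}

/-- The index set `ℤ[β] ∩ X` of the tiles. -/
def tileIndex : Set ℚ⟮β⟯ := {x | x ∈ ringZ β ∧ (x : ℝ) ∈ T.domain}

end Transf

/-! ### Multiple tilings -/

/-- The family of the tiles `t i + D i` is a multiple tiling of the Euclidean space `E`. The number
of tiles that contain a point is counted in the family, i.e. it is a number of indices. -/
structure IsMultipleTiling {E ι : Type*} [NormedAddCommGroup E] [InnerProductSpace ℝ E]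
    [FiniteDimensional ℝ E] [MeasurableSpace E] [BorelSpace E] (t : ι → E) (D : ι → Set E) :
    Prop where
  finite_prototiles : (Set.range D).Finite
  isCompact : ∀ i, IsCompact (D i)
  locallyFinite : ∀ y : E, ∃ r > 0,
    {i | (((fun z => t i + z) '' D i) ∩ Metric.ball y r).Nonempty}.Finite
  covers : ∀ y : E, ∃ i, y ∈ (fun z => t i + z) '' D i
  closure_interior : ∀ i, closure (interior (D i)) = D i
  exists_degree : ∃ m : ℕ, 1 ≤ m ∧
    ∀ᵐ y ∂(MeasureTheory.volume : MeasureTheory.Measure E),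
      {i | y ∈ (fun z => t i + z) '' D i}.encard = m

end

end BetaTiling

namespace BetaTiling

open Filter Topology MeasureTheory

noncomputable section

/-! ### The dual basis and the action of `ℚ(β)` on the contracting hyperplane -/

/-! Write `B` for the action of `β` on `H`. It is a contraction because the other conjugates are
small, and it preserves `Φ(ℤ[β])` in both directions because `β` is a unit. The map `x ↦ x v₁ +
Φ(x)` takes elements of `ℤ[β]` to the standard basis. Hence only finitely many elements of `ℤ[β]`
are bounded together with their images under `Φ` (`finite_ringZ_bounded`), while those in any
interval `[l, r)` have relatively dense images (`exists_ringZ_mem_Ico_near`). The first fact gives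
local finiteness. The second gives covering: the union of the tiles is closed, relatively dense and
mapped into itself by `B`, so shrinking by `B^n` makes it dense.

Finiteness of `𝒱` serves to show that `𝒟_x` is constant between points of `𝒱`
(`prototile_eq_of_lt`). The value of a word is determined by its length and the two end points of
its orbit (`sum_word_coe`). At a point outside `𝒱`, long orbits of `T` and `T̃` ending there can
therefore be exchanged, which identifies the tile of `T` with that of `T̃`. Between such points a
word for `T` can be moved to the right as a word for `T̃` until it hits an image of an end point,
where one switches back to `T`. With words of length `N` there are `O(N)` switches, each with error
`O(ρ^N)`. The left-continuous map is handled as a right-continuous one after reflection `x ↦ -x`.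

So there are finitely many prototiles, and `𝒟_x` is locally constant to the right. Consequently a
patch of tiles seen after translation by `Φ(z)`, with small `z ≥ 0` in `ℤ[β]`, reappears at the
original place under `x ↦ x - z` (`exists_translate_tile`). A closed proper subset of `H` that is
stable under `B⁻¹` and under these backward translations is a null set
(`volume_eq_zero_of_translate`). Applied to the union of the tiles without interior, this
contradicts the positive measure that the support condition gives every tile. Applied to the points
covered more often than the minimum, it gives the constant covering degree. -/

/-- The elements of `ℚ(β)` that are mapped to the standard basis of `ℝ^d`. -/
def dualVec (β : ℝ) (j : Fin (deg β)) : ℚ⟮β⟯ := (minpolyDiv ℚ (gen β)).coeff (deg β - 1 - (j : ℕ))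

section Geometry

variable {β : ℝ}

theorem gen_coe (β : ℝ) : ((gen β : ℚ⟮β⟯) : ℝ) = β := IntermediateField.AdjoinSimple.coe_gen ℚ β

theorem proj₁_eq (h : Space β) : proj₁ β h = ∑ j, (dualVec β j : ℝ) * h j := rfl

theorem aeval_conj (σ : ℚ⟮β⟯ →ₐ[ℚ] ℂ) : Polynomial.aeval (σ (gen β)) (minpoly ℚ β) = 0 := by
  rw [← minpoly_gen, Polynomial.aeval_algHom_apply, minpoly.aeval, map_zero]

theorem abs_coord_le (h : hyperplane β) (j : Fin (deg β)) : |(h : Space β) j| ≤ ‖h‖ := by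
  rw [Submodule.coe_norm, ← Real.norm_eq_abs]
  exact PiLp.norm_apply_le (h : Space β) j

theorem gen_mem : gen β ∈ ringZ β := Algebra.subset_adjoin rfl

variable [IsPisotUnit β]

theorem pos_of_isPisotUnit (β : ℝ) [h : IsPisotUnit β] : 0 < β := one_pos.trans h.one_lt

theorem gen_ne_zero (β : ℝ) [IsPisotUnit β] : gen β ≠ 0 := by
  intro h
  have := gen_coe β
  rw [h] at this
  exact (pos_of_isPisotUnit β).ne this

theorem embedding_injective : Function.Injective (fun σ : ℚ⟮β⟯ →ₐ[ℚ] ℂ => σ (gen β)) :=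
  fun _ _ h => AlgHom.ext_of_adjoin_eq_top (adjoin_gen β) (fun _ hx => hx ▸ h)

/-- Lagrange interpolation: for the minimal polynomial `f`, the quotient `f(X) / (X - σβ)` vanishes
at every conjugate other than `σβ`, and its value there is `f'(σβ)`, which the factor `nu` cancels.
-/
theorem sum_dualVec_mul_eigvec (σ τ : ℚ⟮β⟯ →ₐ[ℚ] ℂ) :
    open scoped Classical in
    ∑ i : Fin (deg β), σ (dualVec β i) * eigvec β τ i = if τ = σ then 1 else 0 := by
  classical
  have h1 := eval₂_minpolyDiv_self (R := ℚ) (gen β) σ τ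
  have hdeg : (minpolyDiv ℚ (gen β)).natDegree < deg β := by
    rw [natDegree_minpolyDiv, minpoly_gen]
    exact Nat.sub_lt (deg_pos β) one_pos
  rw [Polynomial.eval₂_eq_sum_range' _ hdeg] at h1
  have h2 : ∑ i : Fin (deg β), σ (dualVec β i) * eigvec β τ i = nu β τ *
      ∑ i ∈ Finset.range (deg β), σ ((minpolyDiv ℚ (gen β)).coeff i) * τ (gen β) ^ i := by
    rw [← Finset.sum_range_reflect, Finset.mul_sum, ← Fin.sum_univ_eq_sum_range
      (fun j => nu β τ * (σ ((minpolyDiv ℚ (gen β)).coeff (deg β - 1 - j)) *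
        τ (gen β) ^ (deg β - 1 - j)))]
    refine Finset.sum_congr rfl fun i _ => ?_
    rw [eigvec, dualVec]; ring
  rw [h2]
  have h3 : (∑ i ∈ Finset.range (deg β),
        σ ((minpolyDiv ℚ (gen β)).coeff i) * τ (gen β) ^ i) = _ := h1
  rw [h3]
  by_cases hσ : τ = σ
  · subst hσ
    rw [if_pos rfl, if_pos rfl, nu, ← minpoly_gen, Polynomial.aeval_algHom_apply]
    apply inv_mul_cancel₀
    rw [ne_eq, map_eq_zero]
    exact (Algebra.IsSeparable.isSeparable ℚ (gen β)).aeval_derivative_ne_zero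
      (minpoly.aeval _ _)
  · rw [if_neg hσ, if_neg fun h => hσ (embedding_injective h).symm, mul_zero]

/-- The embedding `x ↦ x v₁ + Φ(x)` carries `dualVec j` to `e_j`; rounding the coordinates of a
vector thus produces elements of `ℤ[β]`. -/
theorem dualVec_mul_vec₁_add_phiVec (i j : Fin (deg β)) :
    (dualVec β j : ℝ) * vec₁ β i + phiVec β (dualVec β j) i = if j = i then 1 else 0 := by
  classical
  have h := congrArg Complex.re (sum_eigvec_mul β i (deg β - 1 - (j : ℕ)))
  rw [← Finset.add_sum_erase _ _ (Finset.mem_univ (emb₁ β)), Complex.add_re] at h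
  have e1 : (eigvec β (emb₁ β) i * (emb₁ β) (dualVec β j)).re =
      (dualVec β j : ℝ) * vec₁ β i := by
    rw [mul_comm]
    exact Complex.re_ofReal_mul _ _
  have e2 : (Finset.univ.erase (emb₁ β)) =
      ({σ | σ ≠ emb₁ β} : Finset (ℚ⟮β⟯ →ₐ[ℚ] ℂ)) := by
    ext; simp
  have e3 : phiVec β (dualVec β j) i = (∑ σ : ℚ⟮β⟯ →ₐ[ℚ] ℂ with σ ≠ emb₁ β,
        eigvec β σ i * σ (dualVec β j)).re := by
    simp only [phiVec]
    congr 1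
    exact Finset.sum_congr (by ext; simp) fun σ _ => mul_comm _ _
  rw [← e1, e3, ← e2]
  rw [dualVec]
  rw [h]
  have : (deg β - 1 - (j : ℕ) = deg β - 1 - (i : ℕ)) ↔ j = i := by
    rw [Fin.ext_iff]; omega
  simp only [this]
  split_ifs <;> simp

theorem proj₁_of_mem {h : Space β} (hh : h ∈ hyperplane β) : proj₁ β h = 0 := by
  simpa using proj₁_smul_add β 0 h hh

/-- `Φ` as a homomorphism of groups. -/
def phiHom (β : ℝ) [IsPisotUnit β] : ℚ⟮β⟯ →+ hyperplane β where
  toFun := Phi β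
  map_zero' := by
    ext i; simp [Phi, phiVec]
  map_add' x y := by
    ext i; simp [Phi, phiVec, add_mul, Finset.sum_add_distrib]

theorem Phi_add (x y : ℚ⟮β⟯) : Phi β (x + y) = Phi β x + Phi β y := map_add (phiHom β) x y
theorem Phi_sub (x y : ℚ⟮β⟯) : Phi β (x - y) = Phi β x - Phi β y := map_sub (phiHom β) x y
theorem Phi_neg (x : ℚ⟮β⟯) : Phi β (-x) = -Phi β x := map_neg (phiHom β) x
theorem Phi_sum {ι : Type*} (s : Finset ι) (f : ι → ℚ⟮β⟯) :
    Phi β (∑ i ∈ s, f i) = ∑ i ∈ s, Phi β (f i) := map_sum (phiHom β) f s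
theorem Phi_zsmul (n : ℤ) (x : ℚ⟮β⟯) : Phi β (n • x) = n • Phi β x := map_zsmul (phiHom β) n x

theorem phi_ofReal (x : ℚ⟮β⟯) (i : Fin (deg β)) :
    open scoped Classical in
    (((Phi β x : Space β) i : ℝ) : ℂ) =
      ∑ σ : ℚ⟮β⟯ →ₐ[ℚ] ℂ with σ ≠ emb₁ β, σ x * eigvec β σ i := phiVec_ofReal β x i

/-- The conjugates of `x` are linear functionals of `Φ(x)`. -/
theorem sum_dualVec_mul_Phi {σ : ℚ⟮β⟯ →ₐ[ℚ] ℂ} (hσ : σ ≠ emb₁ β) (x : ℚ⟮β⟯) :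
    ∑ j, σ (dualVec β j) * (((Phi β x : Space β) j : ℝ) : ℂ) = σ x := by
  classical
  simp only [phi_ofReal, Finset.mul_sum]
  rw [Finset.sum_comm]
  have : ∀ τ : ℚ⟮β⟯ →ₐ[ℚ] ℂ, ∑ j, σ (dualVec β j) * (τ x * eigvec β τ j) =
      if τ = σ then τ x else 0 := by
    intro τ
    have h := sum_dualVec_mul_eigvec σ τ
    calc _ = τ x * ∑ j, σ (dualVec β j) * eigvec β τ j := by
          rw [Finset.mul_sum]; exact Finset.sum_congr rfl fun j _ => by ring
      _ = _ := by rw [h]; split_ifs <;> simp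
  simp only [this]
  rw [Finset.sum_ite_eq']
  simp [hσ]

/-- This is `h = ∑ h_j e_j` split along `v₁` and `H`; the coefficient of `v₁` is `proj₁ β h = 0`. -/
theorem eq_sum_smul_Phi (h : hyperplane β) :
    h = ∑ j, (h : Space β) j • Phi β (dualVec β j) := by
  ext i
  have h0 := proj₁_of_mem h.2
  rw [proj₁_eq] at h0
  have h1 : (h : Space β) i = ∑ j, (h : Space β) j *
      ((dualVec β j : ℝ) * vec₁ β i + phiVec β (dualVec β j) i) := by
    simp [dualVec_mul_vec₁_add_phiVec]
  rw [h1]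
  simp only [mul_add, Finset.sum_add_distrib]
  have h2 : ∑ j, (h : Space β) j * ((dualVec β j : ℝ) * vec₁ β i) = 0 := by
    rw [← zero_mul (vec₁ β i), ← h0, Finset.sum_mul]
    exact Finset.sum_congr rfl fun j _ => by ring
  rw [h2, zero_add]
  simp [Phi]

/-- The action of `c ∈ ℚ(β)` on the contracting hyperplane. -/
def mulMap (c : ℚ⟮β⟯) : hyperplane β →ₗ[ℝ] hyperplane β where
  toFun h := ∑ j, (h : Space β) j • Phi β (c * dualVec β j)
  map_add' h k := by simp [add_smul, Finset.sum_add_distrib]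
  map_smul' a h := by simp [mul_smul, Finset.smul_sum]

theorem mulMap_apply (c : ℚ⟮β⟯) (h : hyperplane β) :
    mulMap c h = ∑ j, (h : Space β) j • Phi β (c * dualVec β j) := rfl

/-- `mulMap` uses the ambient coordinates, that is, the spanning family `Φ(dualVec j)`. It extends
multiplication by `c` because every conjugate of `x` other than `x` itself is a linear functional of
`Φ(x)`. -/
theorem mulMap_Phi (c x : ℚ⟮β⟯) : mulMap c (Phi β x) = Phi β (c * x) := by
  classical
  ext i
  apply Complex.ofReal_injective
  have : ((mulMap c (Phi β x) : hyperplane β) : Space β) i =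
      ∑ j, (Phi β x : Space β) j * (Phi β (c * dualVec β j) : Space β) i := by
    simp [mulMap_apply]
  rw [this, phi_ofReal, Complex.ofReal_sum]
  simp only [Complex.ofReal_mul]
  simp only [phi_ofReal _ i, Finset.mul_sum]
  rw [Finset.sum_comm]
  refine Finset.sum_congr rfl fun σ hσ => ?_
  rw [map_mul, ← sum_dualVec_mul_Phi (Finset.mem_filter.mp hσ).2 x, Finset.mul_sum, Finset.sum_mul]
  refine Finset.sum_congr rfl fun j _ => ?_
  rw [map_mul]; ring

theorem mulMap_mulMap (c c' : ℚ⟮β⟯) (h : hyperplane β) :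
    mulMap c (mulMap c' h) = mulMap (c * c') h := by
  rw [mulMap_apply c', map_sum, mulMap_apply (c * c')]
  refine Finset.sum_congr rfl fun j _ => ?_
  rw [map_smul, mulMap_Phi, mul_assoc]

theorem mulMap_one (h : hyperplane β) : mulMap 1 h = h := by
  rw [mulMap_apply]
  simp only [one_mul]
  exact (eq_sum_smul_Phi h).symm

theorem mulMap_inv_mulMap {c : ℚ⟮β⟯} (hc : c ≠ 0) (h : hyperplane β) :
    mulMap c⁻¹ (mulMap c h) = h := by
  rw [mulMap_mulMap, inv_mul_cancel₀ hc, mulMap_one]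

theorem mulMap_mulMap_inv {c : ℚ⟮β⟯} (hc : c ≠ 0) (h : hyperplane β) :
    mulMap c (mulMap c⁻¹ h) = h := by
  rw [mulMap_mulMap, mul_inv_cancel₀ hc, mulMap_one]

theorem mulMap_continuous (c : ℚ⟮β⟯) : Continuous (mulMap (β := β) c) :=
  LinearMap.continuous_of_finiteDimensional _

/-- The action of `c ≠ 0` as a homeomorphism. -/
def mulHomeo {c : ℚ⟮β⟯} (hc : c ≠ 0) : hyperplane β ≃ₜ hyperplane β where
  toFun := mulMap c
  invFun := mulMap c⁻¹
  left_inv := mulMap_inv_mulMap hc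
  right_inv := mulMap_mulMap_inv hc
  continuous_toFun := mulMap_continuous c
  continuous_invFun := mulMap_continuous c⁻¹

/-! ### Contraction -/

theorem norm_conj_lt_one {σ : ℚ⟮β⟯ →ₐ[ℚ] ℂ} (hσ : σ ≠ emb₁ β) : ‖σ (gen β)‖ < 1 := by
  refine IsPisotUnit.norm_conj_lt_one _ (aeval_conj σ) fun h => hσ (embedding_injective ?_)
  have : emb₁ β (gen β) = (β : ℂ) := by
    change (((gen β : ℚ⟮β⟯) : ℝ) : ℂ) = β
    rw [gen_coe]
  simp only [h, this]

theorem exists_rate (β : ℝ) [IsPisotUnit β] :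
    ∃ ρ : ℝ, 0 < ρ ∧ ρ < 1 ∧ ∀ σ : ℚ⟮β⟯ →ₐ[ℚ] ℂ, σ ≠ emb₁ β → ‖σ (gen β)‖ ≤ ρ := by
  classical
  have : ∃ ρ : ℝ, ρ < 1 ∧ ∀ σ ∈ (Finset.univ : Finset (ℚ⟮β⟯ →ₐ[ℚ] ℂ)), σ ≠ emb₁ β →
      ‖σ (gen β)‖ ≤ ρ := by
    induction (Finset.univ : Finset (ℚ⟮β⟯ →ₐ[ℚ] ℂ)) using Finset.induction_on with
    | empty => exact ⟨0, one_pos, by simp⟩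
    | insert σ s _ ih =>
      obtain ⟨ρ, h1, h2⟩ := ih
      by_cases hσ : σ = emb₁ β
      · refine ⟨ρ, h1, fun τ hτ hne => ?_⟩
        rcases Finset.mem_insert.mp hτ with rfl | h
        · exact absurd hσ hne
        · exact h2 τ h hne
      · refine ⟨max ρ ‖σ (gen β)‖, max_lt h1 (norm_conj_lt_one hσ), fun τ hτ hne => ?_⟩
        rcases Finset.mem_insert.mp hτ with rfl | h
        · exact le_max_right _ _
        · exact (h2 τ h hne).trans (le_max_left _ _)
  obtain ⟨ρ, h1, h2⟩ := this
  -- The induction bounds `ρ` only from above; the maximum makes it positive.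
  exact ⟨max ρ (1 / 2), lt_max_of_lt_right (by norm_num), max_lt h1 (by norm_num),
    fun σ hσ => (h2 σ (Finset.mem_univ _) hσ).trans (le_max_left _ _)⟩

/-- A common contraction rate of the conjugates. -/
def rate (β : ℝ) [IsPisotUnit β] : ℝ := (exists_rate β).choose

theorem rate_pos : 0 < rate β := (exists_rate β).choose_spec.1
theorem rate_lt_one : rate β < 1 := (exists_rate β).choose_spec.2.1
theorem norm_conj_le_rate {σ : ℚ⟮β⟯ →ₐ[ℚ] ℂ} (hσ : σ ≠ emb₁ β) : ‖σ (gen β)‖ ≤ rate β :=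
  (exists_rate β).choose_spec.2.2 σ hσ

theorem exists_norm_Phi_le (a : ℚ⟮β⟯) :
    ∃ C : ℝ, 0 ≤ C ∧ ∀ n : ℕ, ‖Phi β (a * gen β ^ n)‖ ≤ C * rate β ^ n := by
  classical
  refine ⟨∑ i : Fin (deg β), ∑ σ : ℚ⟮β⟯ →ₐ[ℚ] ℂ with σ ≠ emb₁ β, ‖σ a‖ * ‖eigvec β σ i‖,
    by positivity, fun n => ?_⟩
  have h1 : ‖Phi β (a * gen β ^ n)‖ ≤ ∑ i, |(Phi β (a * gen β ^ n) : Space β) i| := by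
    rw [Submodule.coe_norm, EuclideanSpace.norm_eq]
    refine Real.sqrt_le_iff.mpr ⟨by positivity, ?_⟩
    simp only [Real.norm_eq_abs]
    exact Finset.sum_sq_le_sq_sum_of_nonneg fun _ _ => abs_nonneg _
  refine h1.trans ?_
  rw [Finset.sum_mul]
  refine Finset.sum_le_sum fun i _ => ?_
  have h2 : |(Phi β (a * gen β ^ n) : Space β) i| =
      ‖(((Phi β (a * gen β ^ n) : Space β) i : ℝ) : ℂ)‖ := by
    rw [Complex.norm_real, Real.norm_eq_abs]
  rw [h2, phi_ofReal, Finset.sum_mul]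
  refine (norm_sum_le _ _).trans (Finset.sum_le_sum fun σ hσ => ?_)
  rw [norm_mul, map_mul, map_pow, norm_mul, norm_pow]
  have := pow_le_pow_left₀ (norm_nonneg _) (norm_conj_le_rate (Finset.mem_filter.mp hσ).2) n
  calc ‖σ a‖ * ‖σ (gen β)‖ ^ n * ‖eigvec β σ i‖
      ≤ ‖σ a‖ * rate β ^ n * ‖eigvec β σ i‖ := by gcongr
    _ = _ := by ring

theorem exists_norm_mulMap_pow_le (β : ℝ) [IsPisotUnit β] :
    ∃ C : ℝ, 0 ≤ C ∧ ∀ (n : ℕ) (h : hyperplane β), ‖mulMap (gen β ^ n) h‖ ≤ C * rate β ^ n * ‖h‖ := by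
  choose C hC0 hC using fun j => exists_norm_Phi_le (dualVec β j)
  refine ⟨∑ j, C j, Finset.sum_nonneg fun j _ => hC0 j, fun n h => ?_⟩
  rw [mulMap_apply, Finset.sum_mul, Finset.sum_mul]
  refine (norm_sum_le _ _).trans (Finset.sum_le_sum fun j _ => ?_)
  rw [norm_smul, mul_comm (gen β ^ n), Real.norm_eq_abs]
  have := hC j n
  have := abs_coord_le h j
  have := pow_nonneg (rate_pos (β := β)).le n
  calc _ ≤ ‖h‖ * (C j * rate β ^ n) := by gcongr
    _ = _ := by ring

theorem tendsto_mulMap_pow (h : hyperplane β) :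
    Tendsto (fun n : ℕ => mulMap (gen β ^ n) h) atTop (𝓝 0) := by
  obtain ⟨C, _, hC⟩ := exists_norm_mulMap_pow_le β
  refine squeeze_zero_norm (fun n => hC n h) ?_
  have := (tendsto_pow_atTop_nhds_zero_of_lt_one (rate_pos (β := β)).le rate_lt_one)
  simpa using (this.const_mul C).mul_const ‖h‖

/-! ### The lattice `ℤ[β]` -/

theorem isIntegral_gen : IsIntegral ℤ (gen β) := by
  have h : IsIntegral ℤ (algebraMap ℚ⟮β⟯ ℝ (gen β)) := by
    have : algebraMap ℚ⟮β⟯ ℝ (gen β) = β := gen_coe β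
    rw [this]; exact IsPisotUnit.isIntegral
  exact (isIntegral_algebraMap_iff (algebraMap ℚ⟮β⟯ ℝ).injective).mp h

theorem isIntegral_of_mem_ringZ {x : ℚ⟮β⟯} (hx : x ∈ ringZ β) : IsIntegral ℤ x :=
  (Algebra.adjoin_le (S := integralClosure ℤ ℚ⟮β⟯)
    (Set.singleton_subset_iff.mpr isIntegral_gen)) hx

theorem dualVec_mem (j : Fin (deg β)) : dualVec β j ∈ ringZ β := by
  have h := coeff_minpolyDiv_mem_adjoin (R := ℤ) (gen β) (deg β - 1 - (j : ℕ))
  have h2 := minpolyDiv_eq_of_isIntegrallyClosed (R := ℤ) ℚ (isIntegral_gen (β := β))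
  rw [h2] at h
  exact h

/-- This is where the constant coefficient `±1` enters: the minimal equation reads `q(β) β = ∓1`
with `q = divX`. -/
theorem gen_inv_mem : (gen β)⁻¹ ∈ ringZ β := by
  have hm := minpoly.isIntegrallyClosed_eq_field_fractions' ℚ (isIntegral_gen (β := β))
  have h0 := IsPisotUnit.abs_coeff_zero (β := β)
  rw [← minpoly_gen, hm, Polynomial.coeff_map] at h0
  set p := minpoly ℤ (gen β) with hp
  have hc : |p.coeff 0| = 1 := by
    have : |((p.coeff 0 : ℤ) : ℚ)| = 1 := by simpa using h0
    exact_mod_cast this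
  have he : Polynomial.aeval (gen β) p = 0 := minpoly.aeval _ _
  rw [← Polynomial.divX_mul_X_add p] at he
  simp only [map_add, map_mul, Polynomial.aeval_X, Polynomial.aeval_C] at he
  set q := Polynomial.aeval (gen β) p.divX with hq
  have hqm : q ∈ ringZ β := Polynomial.aeval_mem_adjoin_singleton ℤ (gen β)
  have hg := gen_ne_zero β
  rcases (abs_eq (zero_le_one)).mp hc with h | h
  · rw [h] at he
    have : (gen β)⁻¹ = -q := by
      rw [inv_eq_iff_eq_inv, eq_comm, inv_eq_of_mul_eq_one_right]
      have : q * gen β = -1 := by simpa using eq_neg_of_add_eq_zero_left he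
      linear_combination -this
    rw [this]; exact neg_mem hqm
  · rw [h] at he
    have : (gen β)⁻¹ = q := by
      rw [inv_eq_iff_eq_inv, eq_comm, inv_eq_of_mul_eq_one_right]
      have : q * gen β = 1 := by simpa [add_neg_eq_zero] using he
      exact this
    rw [this]; exact hqm

/-- Algebraic integers of a number field with all conjugates bounded are finite in number. One
conjugate is bounded by `C`, the others through `Φ(x)`. -/
theorem finite_ringZ_bounded (C C' : ℝ) (p : hyperplane β) :
    {x : ℚ⟮β⟯ | x ∈ ringZ β ∧ |(x : ℝ)| ≤ C ∧ ‖Phi β x - p‖ ≤ C'}.Finite := by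
  classical
  have : NumberField ℚ⟮β⟯ := ⟨⟩
  set S : ℝ := ∑ σ : ℚ⟮β⟯ →ₐ[ℚ] ℂ, ∑ j, ‖σ (dualVec β j)‖ * (C' + ‖p‖) with hS
  refine (NumberField.Embeddings.finite_of_norm_le ℚ⟮β⟯ ℂ (max C S)).subset ?_
  rintro x ⟨hx, hxC, hxC'⟩
  refine ⟨isIntegral_of_mem_ringZ hx, fun φ => ?_⟩
  have hC' : ‖Phi β x‖ ≤ C' + ‖p‖ := by
    have := norm_add_le (Phi β x - p) p
    rw [sub_add_cancel] at this
    linarith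
  have h0 : 0 ≤ C' + ‖p‖ := (norm_nonneg _).trans hC'
  set σ : ℚ⟮β⟯ →ₐ[ℚ] ℂ := φ.toRatAlgHom with hσ
  have hφ : φ x = σ x := rfl
  rw [hφ]
  by_cases h : σ = emb₁ β
  · rw [h]
    refine le_trans ?_ (le_max_left _ _)
    change ‖((x : ℝ) : ℂ)‖ ≤ C
    rwa [Complex.norm_real, Real.norm_eq_abs]
  · refine le_trans ?_ (le_max_right _ _)
    rw [← sum_dualVec_mul_Phi h x]
    refine (norm_sum_le _ _).trans ?_
    refine le_trans ?_ (Finset.single_le_sum (f := fun σ : ℚ⟮β⟯ →ₐ[ℚ] ℂ =>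
      ∑ j, ‖σ (dualVec β j)‖ * (C' + ‖p‖)) (fun _ _ => by positivity) (Finset.mem_univ σ))
    refine Finset.sum_le_sum fun j _ => ?_
    rw [norm_mul, Complex.norm_real, Real.norm_eq_abs]
    have := (abs_coord_le (Phi β x) j).trans hC'
    gcongr

/-- Round the coordinates of `p` in `ℝ^d` down. The error has coordinates in `[0, 1)`, so its
`v₁`-coordinate and its part in `H` are both bounded, and `p` itself has `v₁`-coordinate `0`. -/
theorem exists_ringZ_near (β : ℝ) [IsPisotUnit β] :
    ∃ C R : ℝ, ∀ p : hyperplane β, ∃ x ∈ ringZ β, |(x : ℝ)| ≤ C ∧ ‖Phi β x - p‖ ≤ R := by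
  refine ⟨∑ j, |(dualVec β j : ℝ)|, ∑ j, ‖Phi β (dualVec β j)‖, fun p => ?_⟩
  refine ⟨∑ j, ⌊(p : Space β) j⌋ • dualVec β j,
    Subalgebra.sum_mem _ fun j _ => Subalgebra.zsmul_mem _ (dualVec_mem j) _, ?_, ?_⟩
  · have h0 := proj₁_of_mem p.2
    rw [proj₁_eq] at h0
    have : ((∑ j, ⌊(p : Space β) j⌋ • dualVec β j : ℚ⟮β⟯) : ℝ) =
        ∑ j, (-Int.fract ((p : Space β) j)) * (dualVec β j : ℝ) := by
      rw [← sub_zero ((_ : ℚ⟮β⟯) : ℝ), ← h0]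
      push_cast
      rw [← Finset.sum_sub_distrib]
      refine Finset.sum_congr rfl fun j _ => ?_
      have hf := Int.self_sub_floor ((p : Space β) j)
      simp
      linear_combination -(dualVec β j : ℝ) * hf
    rw [this]
    refine (Finset.abs_sum_le_sum_abs _ _).trans (Finset.sum_le_sum fun j _ => ?_)
    rw [abs_mul, abs_neg, abs_of_nonneg (Int.fract_nonneg _)]
    exact mul_le_of_le_one_left (abs_nonneg _) (Int.fract_lt_one _).le
  · have : Phi β (∑ j, ⌊(p : Space β) j⌋ • dualVec β j) - p =
        ∑ j, (-Int.fract ((p : Space β) j)) • Phi β (dualVec β j) := by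
      conv_lhs => rw [eq_sum_smul_Phi p]
      rw [Phi_sum]
      nth_rewrite 1 [← eq_sum_smul_Phi p]
      rw [← Finset.sum_sub_distrib]
      refine Finset.sum_congr rfl fun j _ => ?_
      rw [Phi_zsmul, ← Int.self_sub_floor, neg_sub, sub_smul, Int.cast_smul_eq_zsmul]
    rw [this]
    refine (norm_sum_le _ _).trans (Finset.sum_le_sum fun j _ => ?_)
    rw [norm_smul, Real.norm_eq_abs, abs_neg, abs_of_nonneg (Int.fract_nonneg _)]
    exact mul_le_of_le_one_left (norm_nonneg _) (Int.fract_lt_one _).le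

/-- The image under `Φ` of the elements of `ℤ[β]` in an interval is relatively dense. -/
theorem exists_ringZ_mem_Ico_near {l r : ℝ} (hlr : l < r) :
    ∃ R : ℝ, ∀ p : hyperplane β, ∃ x ∈ ringZ β, (x : ℝ) ∈ Set.Ico l r ∧ ‖Phi β x - p‖ ≤ R := by
  obtain ⟨C, R, h⟩ := exists_ringZ_near β
  have hβ := IsPisotUnit.one_lt (β := β)
  have hβ0 := pos_of_isPisotUnit β
  have hC : 0 ≤ C := by
    obtain ⟨x, _, hx, _⟩ := h 0
    exact (abs_nonneg _).trans hx
  -- Expand by `β^n` until the interval is longer than `4C + 4`. An element of absolute value at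
  -- most `C` added to the rounded midpoint then stays inside, and multiplication by the unit
  -- `β^(-n)` brings it back within `ℤ[β]`.
  obtain ⟨n, hn⟩ : ∃ n : ℕ, (4 * C + 4) / (r - l) < β ^ n := pow_unbounded_of_one_lt _ hβ
  rw [div_lt_iff₀ (sub_pos.mpr hlr)] at hn
  have hβn : 0 < β ^ n := by positivity
  obtain ⟨M, _, hM⟩ : ∃ M : ℝ, 0 ≤ M ∧ ∀ h : hyperplane β, ‖mulMap ((gen β)⁻¹ ^ n) h‖ ≤ M * ‖h‖ := by
    let L := LinearMap.toContinuousLinearMap (mulMap (β := β) ((gen β)⁻¹ ^ n))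
    exact ⟨‖L‖, L.opNorm_nonneg, L.le_opNorm⟩
  set k : ℤ := ⌊β ^ n * ((l + r) / 2)⌋ with hk
  set x₀ : ℚ⟮β⟯ := (gen β)⁻¹ ^ n * k with hx₀
  have hx₀m : x₀ ∈ ringZ β :=
    Subalgebra.mul_mem _ (Subalgebra.pow_mem _ gen_inv_mem _) (Subalgebra.intCast_mem _ _)
  refine ⟨M * R, fun p => ?_⟩
  obtain ⟨y, hy, hyC, hyR⟩ := h (mulMap (gen β ^ n) (p - Phi β x₀))
  refine ⟨x₀ + (gen β)⁻¹ ^ n * y, Subalgebra.add_mem _ hx₀m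
    (Subalgebra.mul_mem _ (Subalgebra.pow_mem _ gen_inv_mem _) hy), ?_, ?_⟩
  · have hc : ((x₀ + (gen β)⁻¹ ^ n * y : ℚ⟮β⟯) : ℝ) = (k + y) / β ^ n := by
      rw [hx₀]; push_cast; rw [gen_coe, inv_pow]; field_simp
    rw [hc, Set.mem_Ico, le_div_iff₀ hβn, div_lt_iff₀ hβn]
    have h1 := Int.floor_le (β ^ n * ((l + r) / 2))
    have h2 := Int.lt_floor_add_one (β ^ n * ((l + r) / 2))
    have h3 := abs_le.mp hyC
    rw [← hk] at h1 h2
    constructor <;> nlinarith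
  · have : Phi β (x₀ + (gen β)⁻¹ ^ n * y) - p =
        mulMap ((gen β)⁻¹ ^ n) (Phi β y - mulMap (gen β ^ n) (p - Phi β x₀)) := by
      rw [map_sub, mulMap_Phi, inv_pow, mulMap_inv_mulMap (pow_ne_zero _ (gen_ne_zero β)), Phi_add]
      abel
    rw [this]
    exact (hM _).trans (mul_le_mul_of_nonneg_left hyR ‹_›)

end Geometry

/-! ### A criterion for null sets -/

section NullSets

variable {E : Type*} [NormedAddCommGroup E] [MeasurableSpace E] [BorelSpace E]

/-- Choose an open `U ⊇ K` of hardly larger measure. For small `v`, the points that leave `K` are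
moved into `U \ K`. -/
theorem tendsto_measure_notMem_translate (μ : Measure E) [μ.IsAddLeftInvariant]
    [μ.OuterRegular] [IsFiniteMeasureOnCompacts μ] {K : Set E} (hK : IsCompact K) :
    Tendsto (fun v : E => μ {p | p ∈ K ∧ v + p ∉ K}) (𝓝 0) (𝓝 0) := by
  rw [ENNReal.tendsto_nhds_zero]
  intro δ hδ
  obtain ⟨U, hKU, hU, hμU⟩ := K.exists_isOpen_lt_add (μ := μ) hK.measure_lt_top.ne hδ.ne'
  obtain ⟨r, hr, hrU⟩ := hK.exists_thickening_subset_open hU hKU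
  filter_upwards [Metric.ball_mem_nhds (0 : E) hr] with v hv
  have hsub : {p | p ∈ K ∧ v + p ∉ K} ⊆ (fun p => v + p) ⁻¹' (U \ K) := by
    rintro p ⟨hp, hvp⟩
    refine ⟨hrU (Metric.mem_thickening_iff.mpr ⟨p, hp, ?_⟩), hvp⟩
    simpa [dist_eq_norm] using hv
  refine (measure_mono hsub).trans ?_
  rw [measure_preimage_add, measure_sdiff hKU hK.measurableSet.nullMeasurableSet hK.measure_lt_top.ne]
  exact tsub_le_iff_left.mpr hμU.le

/-- A compact `K ⊆ N` is covered by the finitely many sets of points that leave `K` under one of the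
translations `B n u`, and the measures of these sets tend to `0`. -/
theorem measure_eq_zero_of_translates_avoid [ProperSpace E] (μ : Measure E) [μ.IsAddLeftInvariant]
    [μ.OuterRegular] [μ.InnerRegular] [IsFiniteMeasureOnCompacts μ] {N : Set E} (hN : IsClosed N)
    (F : Finset E) (B : ℕ → E → E) (hB : ∀ u ∈ F, Tendsto (fun n => B n u) atTop (𝓝 0))
    (h : ∀ n, ∀ p ∈ N, ∃ u ∈ F, B n u + p ∉ N) : μ N = 0 := by
  by_contra hne
  obtain ⟨K, hKN, hK, hμK⟩ := hN.measurableSet.exists_lt_isCompact (pos_iff_ne_zero.mpr hne)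
  have h1 : ∀ n, μ K ≤ ∑ u ∈ F, μ {p | p ∈ K ∧ B n u + p ∉ K} := by
    intro n
    refine (measure_mono ?_).trans (measure_biUnion_finset_le F _)
    intro p hp
    obtain ⟨u, hu, hup⟩ := h n p (hKN hp)
    exact Set.mem_biUnion hu ⟨hp, fun hc => hup (hKN hc)⟩
  have h2 : Tendsto (fun n => ∑ u ∈ F, μ {p | p ∈ K ∧ B n u + p ∉ K}) atTop (𝓝 0) := by
    rw [← Finset.sum_const_zero (s := F)]
    exact tendsto_finsetSum _ fun u hu =>
      (tendsto_measure_notMem_translate μ hK).comp (hB u hu)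
  exact hμK.not_ge (ge_of_tendsto' h2 h1)

end NullSets

/-! ### The map `φ` on left-infinite sequences -/

section PhiSeq

variable {β : ℝ} [IsPisotUnit β]

theorem exists_norm_Phi_digit_le (S : Finset ℚ⟮β⟯) :
    ∃ C : ℝ, 0 ≤ C ∧ ∀ a ∈ S, ∀ n : ℕ, ‖Phi β (a * gen β ^ n)‖ ≤ C * rate β ^ n := by
  choose C hC0 hC using fun a : ℚ⟮β⟯ => exists_norm_Phi_le a
  refine ⟨∑ a ∈ S, C a, Finset.sum_nonneg fun a _ => hC0 a, fun a ha n => (hC a n).trans ?_⟩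
  exact mul_le_mul_of_nonneg_right (Finset.single_le_sum (fun a _ => hC0 a) ha)
    (pow_nonneg rate_pos.le _)

theorem summable_phiSeq {S : Finset ℚ⟮β⟯} {w : ℕ → ℚ⟮β⟯} (hw : ∀ n, w n ∈ S) :
    Summable fun n : ℕ => Phi β (w n * gen β ^ n) := by
  obtain ⟨C, _, hC⟩ := exists_norm_Phi_digit_le S
  exact Summable.of_norm_bounded
    ((summable_geometric_of_lt_one rate_pos.le rate_lt_one).mul_left C) fun n => hC _ (hw n) n

theorem exists_norm_phiSeq_le (S : Finset ℚ⟮β⟯) :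
    ∃ M : ℝ, 0 ≤ M ∧ ∀ w : ℕ → ℚ⟮β⟯, (∀ n, w n ∈ S) → ‖phiSeq β w‖ ≤ M := by
  obtain ⟨C, hC0, hC⟩ := exists_norm_Phi_digit_le S
  refine ⟨C * (1 - rate β)⁻¹, mul_nonneg hC0 (inv_nonneg.mpr (sub_nonneg.mpr rate_lt_one.le)),
    fun w hw => ?_⟩
  exact tsum_of_norm_bounded ((hasSum_geometric_of_lt_one rate_pos.le rate_lt_one).mul_left C)
    fun n => hC _ (hw n) n

theorem phiSeq_eq_add {S : Finset ℚ⟮β⟯} {w : ℕ → ℚ⟮β⟯} (hw : ∀ n, w n ∈ S) (N : ℕ) :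
    phiSeq β w = Phi β (∑ i ∈ Finset.range N, w i * gen β ^ i) +
      mulMap (gen β ^ N) (phiSeq β fun n => w (n + N)) := by
  rw [phiSeq, ← (summable_phiSeq hw).sum_add_tsum_nat_add N, Phi_sum]
  congr 1
  let L := LinearMap.toContinuousLinearMap (mulMap (β := β) (gen β ^ N))
  have hL : ∀ h, L h = mulMap (gen β ^ N) h := fun h => rfl
  rw [← hL, phiSeq, L.map_tsum (summable_phiSeq (S := S) fun n => hw (n + N))]
  refine tsum_congr fun n => ?_
  rw [hL, mulMap_Phi, pow_add]
  congr 1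
  ring

theorem phiSeq_neg (w : ℕ → ℚ⟮β⟯) : phiSeq β (fun n => -w n) = -phiSeq β w := by
  simp [phiSeq, Phi_neg, tsum_neg]

/-- Sequences whose first `N` digits have the same value have `φ`-values that are close. -/
theorem exists_norm_phiSeq_sub_le (S : Finset ℚ⟮β⟯) :
    ∃ C : ℝ, 0 ≤ C ∧ ∀ (w w' : ℕ → ℚ⟮β⟯) (N : ℕ), (∀ n, w n ∈ S) → (∀ n, w' n ∈ S) →
      ∑ i ∈ Finset.range N, w i * gen β ^ i = ∑ i ∈ Finset.range N, w' i * gen β ^ i →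
      ‖phiSeq β w - phiSeq β w'‖ ≤ C * rate β ^ N := by
  obtain ⟨M, hM0, hM⟩ := exists_norm_phiSeq_le S
  obtain ⟨C, hC0, hC⟩ := exists_norm_mulMap_pow_le β
  refine ⟨C * (M + M), by positivity, fun w w' N hw hw' h => ?_⟩
  rw [phiSeq_eq_add hw N, phiSeq_eq_add hw' N, h, add_sub_add_left_eq_sub, ← map_sub]
  refine (hC _ _).trans ?_
  have := (norm_sub_le _ _).trans (add_le_add (hM _ fun n => hw (n + N)) (hM _ fun n => hw' (n + N)))
  have := mul_nonneg hC0 (pow_nonneg (rate_pos (β := β)).le N)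
  nlinarith

end PhiSeq

/-! ### Backward orbits -/

/-- The backward orbit of `x` along the inverse branches `y ↦ (y + w_n) / β`. -/
def backPt (β x : ℝ) (w : ℕ → ℚ⟮β⟯) : ℕ → ℝ
  | 0 => x
  | n + 1 => (backPt β x w n + (w n : ℝ)) / β

namespace Transf

section Basic

variable {β : ℝ} (T : Transf β)

/-- The word `w_{N-1} ⋯ w_0` can be put in front of the expansion of `x`. -/
def IsWord (x : ℝ) (N : ℕ) (w : ℕ → ℚ⟮β⟯) : Prop :=
  ∀ n < N, w n ∈ T.A ∧ backPt β x w (n + 1) ∈ T.piece (w n)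

/-- The left-infinite sequence `⋯ w_1 w_0` can be put in front of the expansion of `x`. -/
def IsPast (x : ℝ) (w : ℕ → ℚ⟮β⟯) : Prop :=
  ∀ n, w n ∈ T.A ∧ backPt β x w (n + 1) ∈ T.piece (w n)

variable {T}

theorem IsPast.isWord {x : ℝ} {w : ℕ → ℚ⟮β⟯} (h : T.IsPast x w) (N : ℕ) : T.IsWord x N w :=
  fun n _ => h n

theorem mem_domain {a : ℚ⟮β⟯} (ha : a ∈ T.A) {x : ℝ} (hx : x ∈ T.piece a) : x ∈ T.domain :=
  Set.mem_biUnion ha hx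

theorem exists_of_mem_domain {x : ℝ} (hx : x ∈ T.domain) : ∃ a ∈ T.A, x ∈ T.piece a := by
  simpa [domain] using hx

theorem digit_eq {a : ℚ⟮β⟯} (ha : a ∈ T.A) {x : ℝ} (hx : x ∈ T.piece a) : T.digit x = a := by
  have h : ∃ a ∈ T.A, x ∈ T.piece a := ⟨a, ha, hx⟩
  rw [digit, dif_pos h]
  by_contra hne
  exact Set.disjoint_left.mp (T.piece_disjoint _ h.choose_spec.1 _ ha hne) h.choose_spec.2 hx

theorem map_eq {a : ℚ⟮β⟯} (ha : a ∈ T.A) {x : ℝ} (hx : x ∈ T.piece a) : T.map x = β * x - a := by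
  rw [map, digit_eq ha hx]

theorem digit_mem {x : ℝ} (hx : x ∈ T.domain) : T.digit x ∈ T.A := by
  obtain ⟨a, ha, h⟩ := exists_of_mem_domain hx
  rwa [digit_eq ha h]

theorem mem_piece_digit {x : ℝ} (hx : x ∈ T.domain) : x ∈ T.piece (T.digit x) := by
  obtain ⟨a, ha, h⟩ := exists_of_mem_domain hx
  rwa [digit_eq ha h]

theorem map_mem {x : ℝ} (hx : x ∈ T.domain) : T.map x ∈ T.domain := by
  obtain ⟨a, ha, h⟩ := exists_of_mem_domain hx
  have h2 : T.map x ∈ ⋃ a ∈ T.A, (fun x : ℝ => β * x - (a : ℝ)) '' icoUnion (T.intervals a) :=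
    Set.mem_biUnion ha ⟨x, h, (map_eq ha h).symm⟩
  rwa [T.image_eq] at h2

theorem iterate_map_mem {x : ℝ} (hx : x ∈ T.domain) (n : ℕ) : T.map^[n] x ∈ T.domain := by
  induction n with
  | zero => exact hx
  | succ n ih => rw [Function.iterate_succ_apply']; exact map_mem ih

theorem exists_preimage {x : ℝ} (hx : x ∈ T.domain) :
    ∃ a ∈ T.A, ∃ y ∈ T.piece a, β * y - a = x := by
  have h : x ∈ ⋃ a ∈ T.A, (fun x : ℝ => β * x - (a : ℝ)) '' icoUnion (T.intervals a) := by
    rw [T.image_eq]; exact hx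
  simp only [Set.mem_iUnion] at h
  obtain ⟨a, ha, y, hy, h⟩ := h
  exact ⟨a, ha, y, hy, h⟩

theorem exists_bound (T : Transf β) : ∃ M : ℝ, ∀ x ∈ T.domain, |x| ≤ M := by
  have h : Bornology.IsBounded T.domain := by
    refine (Bornology.isBounded_biUnion_finset _).mpr fun a _ => ?_
    refine (Bornology.isBounded_biUnion_finset _).mpr fun p _ => Metric.isBounded_Ico _ _
  obtain ⟨M, hM⟩ := h.exists_norm_le
  exact ⟨M, hM⟩

end Basic

end Transf

section BackPt

variable {β : ℝ}

theorem backPt_congr {x : ℝ} {w w' : ℕ → ℚ⟮β⟯} {n : ℕ} (h : ∀ i < n, w i = w' i) :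
    backPt β x w n = backPt β x w' n := by
  induction n with
  | zero => rfl
  | succ n ih =>
    rw [backPt, backPt, ih fun i hi => h i (hi.trans n.lt_succ_self), h n n.lt_succ_self]

theorem backPt_add (x : ℝ) (w : ℕ → ℚ⟮β⟯) (n m : ℕ) :
    backPt β x w (n + m) = backPt β (backPt β x w n) (fun i => w (n + i)) m := by
  induction m with
  | zero => rfl
  | succ m ih => rw [← add_assoc, backPt, ih, backPt]

theorem backPt_neg (x : ℝ) (w : ℕ → ℚ⟮β⟯) (n : ℕ) :
    backPt β (-x) (fun i => -w i) n = -backPt β x w n := by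
  induction n with
  | zero => rfl
  | succ n ih => rw [backPt, backPt, ih]; push_cast; ring

theorem backPt_sub (x z : ℝ) (w : ℕ → ℚ⟮β⟯) (n : ℕ) :
    backPt β z w n - backPt β x w n = (z - x) / β ^ n := by
  induction n with
  | zero => simp [backPt]
  | succ n ih =>
    rw [backPt, backPt, ← sub_div, add_sub_add_right_eq_sub, ih, pow_succ, div_div]

namespace Transf

variable {T : Transf β}

theorem IsWord.congr {x : ℝ} {w w' : ℕ → ℚ⟮β⟯} {N : ℕ} (h : T.IsWord x N w)
    (hw : ∀ i < N, w' i = w i) : T.IsWord x N w' := fun n hn => by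
  rw [hw n hn, backPt_congr (w' := w) fun i hi => hw i (by omega)]
  exact h n hn

theorem IsPast.shift {x : ℝ} {w : ℕ → ℚ⟮β⟯} (h : T.IsPast x w) (N : ℕ) :
    T.IsPast (backPt β x w N) (fun n => w (n + N)) := fun n => by
  have := h (N + n)
  rw [add_assoc, backPt_add] at this
  simpa only [add_comm N] using this

theorem IsWord.append {x : ℝ} {w v : ℕ → ℚ⟮β⟯} {N : ℕ} (h : T.IsWord x N w)
    (hv : T.IsPast (backPt β x w N) v) :
    T.IsPast x (fun n => if n < N then w n else v (n - N)) := by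
  set u : ℕ → ℚ⟮β⟯ := fun n => if n < N then w n else v (n - N) with hu
  have hlt : ∀ i < N, u i = w i := fun i hi => by simp [hu, hi]
  have hge : ∀ i, u (N + i) = v i := fun i => by simp [hu]
  intro n
  rcases lt_or_ge n N with hn | hn
  · exact h.congr hlt n hn
  · obtain ⟨m, rfl⟩ := Nat.exists_eq_add_of_le hn
    rw [hge, add_assoc, backPt_add, backPt_congr hlt]
    simp only [hge]
    exact hv m

theorem IsWord.backPt_mem {x : ℝ} {w : ℕ → ℚ⟮β⟯} {N n : ℕ} (h : T.IsWord x N w)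
    (hx : x ∈ T.domain) (hn : n ≤ N) : backPt β x w n ∈ T.domain := by
  cases n with
  | zero => exact hx
  | succ n => exact mem_domain (h n (by omega)).1 (h n (by omega)).2

theorem expansion_mem {x : ℝ} (hx : x ∈ T.domain) (n : ℕ) : T.expansion x n ∈ T.A :=
  digit_mem (iterate_map_mem hx n)

theorem expansion_map (x : ℝ) (n : ℕ) : T.expansion (T.map x) n = T.expansion x (n + 1) := by
  rw [expansion, expansion, Function.iterate_succ_apply]

end Transf

variable [IsPisotUnit β]

theorem mul_backPt_succ (x : ℝ) (w : ℕ → ℚ⟮β⟯) (n : ℕ) :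
    β * backPt β x w (n + 1) - (w n : ℝ) = backPt β x w n := by
  rw [backPt]
  have := (pos_of_isPisotUnit β).ne'
  field_simp
  ring

theorem backPt_lt {x z : ℝ} (h : x < z) (w : ℕ → ℚ⟮β⟯) (n : ℕ) :
    backPt β x w n < backPt β z w n := by
  rw [← sub_pos, backPt_sub]
  exact div_pos (sub_pos.mpr h) (pow_pos (pos_of_isPisotUnit β) _)

/-- The value of a word is determined by the end points of the orbit. -/
theorem sum_word_coe (x : ℝ) (w : ℕ → ℚ⟮β⟯) (n : ℕ) :
    ((∑ i ∈ Finset.range n, w i * gen β ^ i : ℚ⟮β⟯) : ℝ) = β ^ n * backPt β x w n - x := by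
  induction n with
  | zero => simp [backPt]
  | succ n ih =>
    rw [Finset.sum_range_succ]
    push_cast at ih ⊢
    rw [ih, gen_coe, pow_succ, ← mul_backPt_succ x w n]
    ring

namespace Transf

variable {T : Transf β}

theorem IsWord.map_backPt {x : ℝ} {w : ℕ → ℚ⟮β⟯} {N n : ℕ} (h : T.IsWord x N w) (hn : n < N) :
    T.map (backPt β x w (n + 1)) = backPt β x w n := by
  rw [map_eq (h n hn).1 (h n hn).2, mul_backPt_succ]

theorem IsWord.iterate_backPt {x : ℝ} {w : ℕ → ℚ⟮β⟯} {N : ℕ} (h : T.IsWord x N w) {k n : ℕ}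
    (hn : n + k ≤ N) : T.map^[k] (backPt β x w (n + k)) = backPt β x w n := by
  induction k with
  | zero => rfl
  | succ k ih =>
    rw [Function.iterate_succ_apply, ← add_assoc, h.map_backPt (by omega), ih (by omega)]

/-- The word of the first `N` digits of `y`, read backwards, is a word for `T^N y`. -/
theorem isWord_digits {y : ℝ} (hy : y ∈ T.domain) (N : ℕ) :
    T.IsWord (T.map^[N] y) N (fun i => T.digit (T.map^[N - 1 - i] y)) ∧
    ∀ n ≤ N, backPt β (T.map^[N] y) (fun i => T.digit (T.map^[N - 1 - i] y)) n =
      T.map^[N - n] y := by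
  have h : ∀ n ≤ N, backPt β (T.map^[N] y) (fun i => T.digit (T.map^[N - 1 - i] y)) n =
      T.map^[N - n] y := by
    intro n hn
    induction n with
    | zero => rfl
    | succ n ih =>
      rw [backPt, ih (by omega)]
      have e : N - n = (N - 1 - n) + 1 := by omega
      have e2 : N - (n + 1) = N - 1 - n := by omega
      have hβ := (pos_of_isPisotUnit β).ne'
      rw [e, Function.iterate_succ_apply', e2, map]
      field_simp
      ring
  refine ⟨fun n hn => ?_, h⟩
  rw [h _ hn, show N - (n + 1) = N - 1 - n by omega]
  exact ⟨digit_mem (iterate_map_mem hy _), mem_piece_digit (iterate_map_mem hy _)⟩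

/-- `T` is onto `X`, so preimages can be chosen again and again. -/
theorem exists_isPast {x : ℝ} (hx : x ∈ T.domain) : ∃ w, T.IsPast x w := by
  have h : ∀ x : T.domain, ∃ q : ℚ⟮β⟯ × T.domain, q.1 ∈ T.A ∧ (q.2 : ℝ) ∈ T.piece q.1 ∧
      (q.2 : ℝ) = (x + (q.1 : ℝ)) / β := by
    rintro ⟨x, hx⟩
    obtain ⟨a, ha, y, hy, h⟩ := exists_preimage hx
    refine ⟨(a, ⟨y, mem_domain ha hy⟩), ha, hy, ?_⟩
    change y = (x + (a : ℝ)) / β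
    rw [← h]
    have := (pos_of_isPisotUnit β).ne'
    field_simp
    ring
  choose f hfA hfp hf using h
  let y : ℕ → T.domain := fun n => (fun z => (f z).2)^[n] ⟨x, hx⟩
  have hy : ∀ n, backPt β x (fun n => (f (y n)).1) n = y n := by
    intro n
    induction n with
    | zero => rfl
    | succ n ih =>
      rw [backPt, ih]
      have : y (n + 1) = (f (y n)).2 := Function.iterate_succ_apply' _ _ _
      rw [this, hf]
  refine ⟨fun n => (f (y n)).1, fun n => ⟨hfA _, ?_⟩⟩
  rw [hy]
  have : y (n + 1) = (f (y n)).2 := Function.iterate_succ_apply' _ _ _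
  rw [this]
  exact hfp _

theorem IsWord.exists_isPast {x : ℝ} {w : ℕ → ℚ⟮β⟯} {N : ℕ} (h : T.IsWord x N w)
    (hx : x ∈ T.domain) : ∃ w', T.IsPast x w' ∧ ∀ i < N, w' i = w i := by
  obtain ⟨v, hv⟩ := Transf.exists_isPast (h.backPt_mem hx le_rfl)
  exact ⟨_, h.append hv, fun i hi => by simp [hi]⟩

/-! ### Expansions -/

theorem sum_expansion (x : ℝ) (n : ℕ) :
    ∑ i ∈ Finset.range n, (T.expansion x i : ℝ) / β ^ (i + 1) = x - T.map^[n] x / β ^ n := by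
  induction n with
  | zero => simp
  | succ n ih =>
    rw [Finset.sum_range_succ, ih, Function.iterate_succ_apply', map, expansion]
    have := (pos_of_isPisotUnit β).ne'
    field_simp
    ring

theorem value_expansion {x : ℝ} (hx : x ∈ T.domain) : value β (T.expansion x) = x := by
  have hβ := IsPisotUnit.one_lt (β := β)
  have hβ0 := pos_of_isPisotUnit β
  have hinv : β⁻¹ < 1 := inv_lt_one_of_one_lt₀ hβ
  have hinv0 : 0 ≤ β⁻¹ := inv_nonneg.mpr hβ0.le
  have hs : Summable fun n : ℕ => (T.expansion x n : ℝ) / β ^ (n + 1) := by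
    refine Summable.of_norm_bounded (g := fun n : ℕ => (∑ a ∈ T.A, |(a : ℝ)|) * β⁻¹ * β⁻¹ ^ n)
      ((summable_geometric_of_lt_one hinv0 hinv).mul_left _) fun n => ?_
    rw [norm_div, norm_pow, Real.norm_eq_abs, Real.norm_eq_abs, abs_of_pos hβ0, div_eq_mul_inv,
      mul_assoc, ← pow_succ', inv_pow]
    gcongr
    exact Finset.single_le_sum (f := fun a : ℚ⟮β⟯ => |(a : ℝ)|) (fun _ _ => abs_nonneg _)
      (expansion_mem hx n)
  have h1 := hs.hasSum.tendsto_sum_nat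
  simp only [sum_expansion] at h1
  obtain ⟨M, hM⟩ := T.exists_bound
  have h2 : Tendsto (fun n : ℕ => T.map^[n] x / β ^ n) atTop (𝓝 0) := by
    refine squeeze_zero_norm (a := fun n => M * β⁻¹ ^ n) (fun n => ?_) ?_
    · rw [norm_div, norm_pow, Real.norm_eq_abs, Real.norm_eq_abs, abs_of_pos hβ0, div_eq_mul_inv,
        inv_pow]
      have := hM _ (iterate_map_mem hx n)
      gcongr
    · simpa using (tendsto_pow_atTop_nhds_zero_of_lt_one hinv0 hinv).const_mul M
  have h3 := tendsto_nhds_unique h1 ((tendsto_const_nhds (x := x)).sub h2)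
  rw [sub_zero] at h3
  exact h3

theorem expansion_injOn {x y : ℝ} (hx : x ∈ T.domain) (hy : y ∈ T.domain)
    (h : T.expansion x = T.expansion y) : x = y := by
  rw [← value_expansion hx, ← value_expansion hy, h]

/-! ### Tiles in terms of backward orbits -/

/-- The reversed past followed by the expansion of `x` is the required two-sided sequence: its
truncation at `1 - n` is the expansion of the `n`-th backward point. -/
theorem IsPast.mem_prototile {x : ℝ} (hx : x ∈ T.domain) {w : ℕ → ℚ⟮β⟯} (h : T.IsPast x w) :
    phiSeq β w ∈ T.prototile x := by
  let u : ℤ → ℚ⟮β⟯ := fun k => if 1 ≤ k then T.expansion x (k - 1).toNat else w (-k).toNat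
  have hu1 : ∀ n : ℕ, u (n + 1) = T.expansion x n := fun n => by simp [u]
  have hu2 : ∀ n : ℕ, u (-n) = w n := fun n => by
    simp only [u]
    rw [if_neg (by omega)]
    simp
  have hb : ∀ n, backPt β x w n ∈ T.domain := fun n => (h.isWord n).backPt_mem hx le_rfl
  have hback : ∀ n m : ℕ, T.expansion (backPt β x w n) m = u (1 - n + m) := by
    intro n
    induction n with
    | zero =>
      intro m
      change T.expansion x m = _
      rw [← hu1]; congr 1; push_cast; ring
    | succ n ih =>
      intro m
      cases m with
      | zero =>
        rw [expansion, Function.iterate_zero_apply, digit_eq (h n).1 (h n).2, ← hu2]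
        congr 1; push_cast; ring
      | succ m =>
        rw [← expansion_map, (h.isWord (n + 1)).map_backPt n.lt_succ_self, ih]
        congr 1; push_cast; ring
  refine ⟨u, ⟨fun k => ?_, fun k => ?_⟩, hu1, by simp only [hu2]⟩
  · simp only [u]
    split_ifs
    · exact expansion_mem hx _
    · exact (h _).1
  · rcases le_or_gt 1 k with hk | hk
    · obtain ⟨n, rfl⟩ : ∃ n : ℕ, k = n + 1 := ⟨(k - 1).toNat, by omega⟩
      refine ⟨T.map^[n] x, iterate_map_mem hx n, ?_⟩
      funext m
      rw [show ((n : ℤ) + 1 + m) = ((m + n : ℕ) : ℤ) + 1 by push_cast; ring, hu1, expansion,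
        expansion, Function.iterate_add_apply]
    · obtain ⟨n, rfl⟩ : ∃ n : ℕ, k = 1 - n := ⟨(1 - k).toNat, by omega⟩
      exact ⟨backPt β x w n, hb n, funext fun m => (hback n m).symm⟩

/-- The truncation at `1 - n` is the expansion of some `z n`. As expansions determine points, the `z
n` form the backward orbit of `x`. -/
theorem exists_isPast_of_mem_prototile {x : ℝ} (hx : x ∈ T.domain) {p : hyperplane β}
    (hp : p ∈ T.prototile x) : ∃ w, T.IsPast x w ∧ phiSeq β w = p := by
  obtain ⟨u, ⟨huA, hu⟩, hux, rfl⟩ := hp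
  refine ⟨fun n => u (-n), ?_, rfl⟩
  choose z hz hzu using fun n : ℕ => hu (1 - n)
  have hmap : ∀ n, T.map (z (n + 1)) = z n := fun n => by
    refine expansion_injOn (map_mem (hz _)) (hz _) (funext fun m => ?_)
    rw [expansion_map, ← congrFun (hzu n) m, ← congrFun (hzu (n + 1)) (m + 1)]
    congr 1; push_cast; ring
  have hdig : ∀ n : ℕ, T.digit (z (n + 1)) = u (-n) := fun n => by
    have := congrFun (hzu (n + 1)) 0
    rw [expansion, Function.iterate_zero_apply] at this
    rw [← this]
    congr 1; push_cast; ring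
  have hb : ∀ n, backPt β x (fun n : ℕ => u (-n)) n = z n := by
    intro n
    induction n with
    | zero =>
      refine expansion_injOn hx (hz 0) (funext fun m => ?_)
      change T.expansion x m = _
      rw [← congrFun (hzu 0) m, ← hux m]
      congr 1; push_cast; ring
    | succ n ih =>
      rw [backPt, ih, ← hmap n, map, hdig]
      have := (pos_of_isPisotUnit β).ne'
      field_simp
      ring
  intro n
  change u (-n) ∈ T.A ∧ backPt β x (fun n : ℕ => u (-n)) (n + 1) ∈ T.piece (u (-n))
  rw [hb, ← hdig]
  exact ⟨digit_mem (hz _), mem_piece_digit (hz _)⟩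

theorem prototile_eq_image {x : ℝ} (hx : x ∈ T.domain) :
    T.prototile x = phiSeq β '' {w | T.IsPast x w} :=
  Set.Subset.antisymm (fun _ hp => exists_isPast_of_mem_prototile hx hp)
    (by rintro _ ⟨w, hw, rfl⟩; exact IsPast.mem_prototile hx hw)

theorem prototile_nonempty {x : ℝ} (hx : x ∈ T.domain) : (T.prototile x).Nonempty := by
  obtain ⟨w, hw⟩ := Transf.exists_isPast hx
  exact ⟨_, hw.mem_prototile hx⟩

theorem exists_prototile_bound (T : Transf β) :
    ∃ M : ℝ, 0 ≤ M ∧ ∀ x ∈ T.domain, ∀ p ∈ T.prototile x, ‖p‖ ≤ M := by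
  obtain ⟨M, hM0, hM⟩ := exists_norm_phiSeq_le T.A
  refine ⟨M, hM0, fun x hx p hp => ?_⟩
  obtain ⟨w, hw, rfl⟩ := exists_isPast_of_mem_prototile hx hp
  exact hM w fun n => (hw n).1

/-- Each condition on a past involves finitely many digits, so the pasts are closed in the compact
space `A^ℕ`, although the pieces need not be closed in `ℝ`. On this space `φ` is continuous by the
uniform geometric bound. -/
theorem prototile_isCompact {x : ℝ} (hx : x ∈ T.domain) : IsCompact (T.prototile x) := by
  have hc : Continuous fun w : ℕ → T.A => phiSeq β fun n => (w n : ℚ⟮β⟯) := by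
    obtain ⟨C, _, hC⟩ := exists_norm_Phi_digit_le T.A
    refine continuous_tsum (u := fun n => C * rate β ^ n) (fun n => ?_)
      ((summable_geometric_of_lt_one rate_pos.le rate_lt_one).mul_left C)
      fun n w => hC _ (w n).2 n
    exact (continuous_of_discreteTopology (f := fun a : T.A => Phi β ((a : ℚ⟮β⟯) * gen β ^ n))).comp
      (continuous_apply n)
  have hcl : IsClosed {w : ℕ → T.A | T.IsPast x fun n => (w n : ℚ⟮β⟯)} := by
    have : {w : ℕ → T.A | T.IsPast x fun n => (w n : ℚ⟮β⟯)} =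
        ⋂ n : ℕ, {w : ℕ → T.A | backPt β x (fun n => (w n : ℚ⟮β⟯)) (n + 1) ∈ T.piece (w n)} := by
      ext w; simp [IsPast]
    rw [this]
    refine isClosed_iInter fun n => ?_
    let r : (ℕ → T.A) → (Fin (n + 1) → T.A) := fun w i => w i
    have hr : Continuous r := continuous_pi fun i => continuous_apply _
    have hpre : {w : ℕ → T.A | backPt β x (fun n => (w n : ℚ⟮β⟯)) (n + 1) ∈ T.piece (w n)} =
        r ⁻¹' (r '' {w : ℕ → T.A | backPt β x (fun n => (w n : ℚ⟮β⟯)) (n + 1) ∈ T.piece (w n)}) := by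
      refine Set.Subset.antisymm (Set.subset_preimage_image _ _) ?_
      rintro w ⟨v, hv, hvw⟩
      have h : ∀ i < n + 1, v i = w i := fun i hi => congrFun hvw ⟨i, hi⟩
      simp only [Set.mem_ofPred_eq] at hv ⊢
      rwa [← h n n.lt_succ_self, backPt_congr (w' := fun n => (v n : ℚ⟮β⟯))
        fun i hi => by rw [h i hi]]
    rw [hpre]
    exact (isClosed_discrete _).preimage hr
  have : T.prototile x = (fun w : ℕ → T.A => phiSeq β fun n => (w n : ℚ⟮β⟯)) ''
      {w : ℕ → T.A | T.IsPast x fun n => (w n : ℚ⟮β⟯)} := by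
    rw [prototile_eq_image hx]
    ext p
    constructor
    · rintro ⟨w, hw, rfl⟩
      exact ⟨fun n => ⟨w n, (hw n).1⟩, hw, rfl⟩
    · rintro ⟨w, hw, rfl⟩
      exact ⟨_, hw, rfl⟩
  rw [this]
  exact hcl.isCompact.image hc

/-- The subdivision of the tiles, in both directions. -/
theorem mem_prototile_iff {x : ℝ} (hx : x ∈ T.domain) {p : hyperplane β} :
    p ∈ T.prototile x ↔ ∃ y ∈ T.domain, T.map y = x ∧
      ∃ q ∈ T.prototile y, p = Phi β (T.digit y) + mulMap (gen β) q := by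
  constructor
  · intro hp
    obtain ⟨w, hw, rfl⟩ := exists_isPast_of_mem_prototile hx hp
    have h1 := hw.isWord 1
    refine ⟨backPt β x w 1, h1.backPt_mem hx le_rfl, h1.map_backPt one_pos, _,
      (hw.shift 1).mem_prototile (h1.backPt_mem hx le_rfl), ?_⟩
    rw [phiSeq_eq_add (fun n => (hw n).1) 1, digit_eq (hw 0).1 (hw 0).2]
    simp
  · rintro ⟨y, hy, rfl, q, hq, rfl⟩
    obtain ⟨v, hv, rfl⟩ := exists_isPast_of_mem_prototile hy hq
    obtain ⟨h1, h2⟩ := isWord_digits hy 1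
    have h3 := h2 1 le_rfl
    simp only [Function.iterate_one, Nat.sub_self, zero_tsub, Function.iterate_zero_apply] at h1 h3
    have h4 := h1.append (by rw [h3]; exact hv)
    have h5 := h4.mem_prototile (map_mem hy)
    rw [phiSeq_eq_add (fun n => (h4 n).1) 1] at h5
    simpa using h5

end Transf

end BackPt

/-! ### The left-continuous transformation, reflected at the origin -/

theorem mem_icoUnion {s : Finset (ℝ × ℝ)} {x : ℝ} :
    x ∈ icoUnion s ↔ ∃ p ∈ s, p.1 ≤ x ∧ x < p.2 := by
  simp only [icoUnion, Set.mem_iUnion, Set.mem_Ico, exists_prop]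

theorem mem_iocUnion {s : Finset (ℝ × ℝ)} {x : ℝ} :
    x ∈ iocUnion s ↔ ∃ p ∈ s, p.1 < x ∧ x ≤ p.2 := by
  simp only [iocUnion, Set.mem_iUnion, Set.mem_Ioc, exists_prop]

/-- Left germs describe `(ℓ, r]`-unions through the corresponding `[ℓ, r)`-unions as sets. This
carries disjointness and the image equation from `T` over to `T̃`. -/
theorem mem_iocUnion_iff_eventually {s : Finset (ℝ × ℝ)} {x : ℝ} :
    x ∈ iocUnion s ↔ ∀ᶠ y in 𝓝[<] x, y ∈ icoUnion s := by
  rw [mem_iocUnion]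
  constructor
  · rintro ⟨p, hp, h1, h2⟩
    filter_upwards [Ioo_mem_nhdsLT h1] with y hy
    exact mem_icoUnion.mpr ⟨p, hp, hy.1.le, hy.2.trans_le h2⟩
  · intro h
    by_contra hx
    push Not at hx
    have h2 : ∀ᶠ y in 𝓝[<] x, ∀ p ∈ s, ¬(p.1 ≤ y ∧ y < p.2) := by
      rw [Filter.eventually_all_finset]
      intro p hp
      rcases le_or_gt x p.1 with h1 | h1
      · filter_upwards [self_mem_nhdsWithin] with y hy hc
        exact (hy.trans_le h1).not_ge hc.1
      · filter_upwards [Ioo_mem_nhdsLT (hx p hp h1)] with y hy hc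
        exact hy.1.not_gt hc.2
    obtain ⟨y, hy1, hy2⟩ := (h.and h2).exists
    obtain ⟨p, hp, hpy⟩ := mem_icoUnion.mp hy1
    exact hy2 p hp hpy

theorem iocUnion_congr {s t : Finset (ℝ × ℝ)} (h : icoUnion s = icoUnion t) :
    iocUnion s = iocUnion t := by
  ext x
  rw [mem_iocUnion_iff_eventually, mem_iocUnion_iff_eventually, h]

namespace Transf

/-- `T'` is the left-continuous transformation that belongs to `T`, conjugated by `x ↦ -x`. -/
structure IsReflection {β : ℝ} (T T' : Transf β) : Prop where
  mem_A : ∀ a, a ∈ T.A ↔ -a ∈ T'.A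
  mem_intervals : ∀ a p, p ∈ T.intervals a ↔ (-p.2, -p.1) ∈ T'.intervals (-a)

section Reflection

variable {β : ℝ} {T T' : Transf β}

theorem IsReflection.symm (h : IsReflection T T') : IsReflection T' T where
  mem_A a := by rw [h.mem_A (-a), neg_neg]
  mem_intervals a p := by
    rw [h.mem_intervals (-a) (-p.2, -p.1), neg_neg]
    simp

theorem IsReflection.neg_mem_piece (h : IsReflection T T') {a : ℚ⟮β⟯} {x : ℝ} :
    -x ∈ T'.piece (-a) ↔ x ∈ T.pieceL a := by
  rw [piece, pieceL, mem_icoUnion, mem_iocUnion]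
  constructor
  · rintro ⟨p, hp, h1, h2⟩
    rw [h.symm.mem_intervals, neg_neg] at hp
    exact ⟨_, hp, by dsimp only; linarith, by dsimp only; linarith⟩
  · rintro ⟨p, hp, h1, h2⟩
    rw [h.mem_intervals] at hp
    exact ⟨_, hp, by dsimp only; linarith, by dsimp only; linarith⟩

theorem IsReflection.neg_mem_domain (h : IsReflection T T') {x : ℝ} :
    -x ∈ T'.domain ↔ x ∈ T.domainL := by
  simp only [domain, domainL, Set.mem_iUnion, exists_prop]
  constructor
  · rintro ⟨a, ha, hx⟩
    refine ⟨-a, h.symm.mem_A a |>.mp ha, h.neg_mem_piece.mp ?_⟩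
    rwa [neg_neg]
  · rintro ⟨a, ha, hx⟩
    exact ⟨-a, (h.mem_A a).mp ha, h.neg_mem_piece.mpr hx⟩

theorem IsReflection.map_neg (h : IsReflection T T') {x : ℝ} (hx : x ∈ T.domainL) :
    T'.map (-x) = -T.mapL x := by
  have hex : ∃ a ∈ T.A, x ∈ T.pieceL a := by simpa [domainL] using hx
  rw [mapL, digitL, dif_pos hex, map_eq ((h.mem_A _).mp hex.choose_spec.1)
    (h.neg_mem_piece.mpr hex.choose_spec.2)]
  push_cast; ring

theorem IsReflection.iterate_map_neg (h : IsReflection T T') {x : ℝ} (hx : x ∈ T.domainL) (k : ℕ) :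
    T'.map^[k] (-x) = -T.mapL^[k] x := by
  induction k with
  | zero => rfl
  | succ k ih =>
    rw [Function.iterate_succ_apply', Function.iterate_succ_apply', ih, h.map_neg]
    rw [← h.neg_mem_domain, ← ih]
    exact iterate_map_mem (h.neg_mem_domain.mpr hx) k

/-- The left end points of the intervals. -/
def leftEnds (T : Transf β) : Finset ℝ :=
  open scoped Classical in T.A.biUnion fun a => (T.intervals a).image Prod.fst

theorem fst_mem_leftEnds {a : ℚ⟮β⟯} (ha : a ∈ T.A) {p : ℝ × ℝ} (hp : p ∈ T.intervals a) :
    p.1 ∈ T.leftEnds := by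
  classical
  exact Finset.mem_biUnion.mpr ⟨a, ha, Finset.mem_image_of_mem _ hp⟩

theorem IsReflection.mem_leftEnds (h : IsReflection T T') {x : ℝ} (hx : x ∈ T.domain)
    (hx' : -x ∉ T'.domain) : x ∈ T.leftEnds := by
  obtain ⟨a, ha, hxa⟩ := exists_of_mem_domain hx
  obtain ⟨p, hp, h1, h2⟩ := mem_icoUnion.mp hxa
  rcases h1.eq_or_lt with h3 | h3
  · rw [← h3]; exact fst_mem_leftEnds ha hp
  · refine absurd (mem_domain ((h.mem_A a).mp ha) (h.neg_mem_piece.mpr ?_)) hx'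
    exact mem_iocUnion.mpr ⟨p, hp, h3, h2.le⟩

/-- A point of `X ∩ X̃` that is not hit by the orbits of a discontinuity before they meet. -/
structure IsRegularPt (T T' : Transf β) (z : ℝ) : Prop where
  mem : z ∈ T.domain
  neg_mem : -z ∈ T'.domain
  iterate_ne : ∀ y ∈ T.domain, -y ∈ T'.domain → ∀ k : ℕ, 1 ≤ k →
    (∀ j, 1 ≤ j → j ≤ k → T'.map^[j] (-y) ≠ -T.map^[j] y) →
      T.map^[k] y ≠ z ∧ T'.map^[k] (-y) ≠ -z

theorem IsRegularPt.symm {z : ℝ} (h : IsRegularPt T T' z) : IsRegularPt T' T (-z) where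
  mem := h.neg_mem
  neg_mem := by rw [neg_neg]; exact h.mem
  iterate_ne y hy hy' k hk hj := by
    have := h.iterate_ne (-y) hy' (by rwa [neg_neg]) k hk fun j h1 h2 hc => hj j h1 h2 (by
      rw [neg_neg] at hc; rw [hc, neg_neg])
    rw [neg_neg] at this ⊢
    exact ⟨this.2, this.1⟩

/-- If the two orbits of `y` do not meet at any of the times `1, …, k`, then `k < m_y`, so the
`k`-th images lying in `X` belong to `𝒱`. -/
theorem IsReflection.isRegularPt (h : IsReflection T T') {z : ℝ} (hz : z ∈ T.domain)
    (hV : z ∉ T.V) : IsRegularPt T T' z where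
  mem := hz
  neg_mem := by
    rw [h.neg_mem_domain]
    by_contra hc
    exact hV (Or.inl ⟨hz, hc⟩)
  iterate_ne y hy hy' k hk hj := by
    have hyL := h.neg_mem_domain.mp hy'
    have hlt : (k : ℕ∞) < T.meetingTime y := by
      refine lt_of_lt_of_le (b := ((k + 1 : ℕ) : ℕ∞)) (by exact_mod_cast k.lt_succ_self)
        (le_sInf ?_)
      rintro _ ⟨j, rfl, hj1, hj2⟩
      by_contra hc
      have hjk : j ≤ k := by
        have : j < k + 1 := by exact_mod_cast not_le.mp hc
        omega
      exact hj j hj1 hjk (by rw [h.iterate_map_neg hyL, hj2])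
    have key : ∀ v ∈ ({T.map^[k] y, T.mapL^[k] y} : Set ℝ), v ≠ z := by
      rintro v hv rfl
      refine hV (Or.inr ?_)
      simp only [Set.mem_iUnion]
      exact ⟨y, ⟨hy, hyL⟩, k, ⟨hk, hlt⟩, hv, hz⟩
    refine ⟨key _ (Or.inl rfl), ?_⟩
    rw [h.iterate_map_neg hyL, ne_eq, neg_inj]
    exact key _ (Or.inr rfl)

end Reflection

/-! ### Existence of the reflected transformation. -/

section Existence

variable {β : ℝ} [IsPisotUnit β] (T : Transf β)

/-- Both sides are `(ℓ, r]`-versions of finite unions of intervals whose `[ℓ, r)`-versions agree by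
`image_eq`. -/
theorem imageL_eq : ⋃ a ∈ T.A, (fun x : ℝ => β * x - (a : ℝ)) '' iocUnion (T.intervals a) =
    ⋃ a ∈ T.A, iocUnion (T.intervals a) := by
  classical
  have hβ := pos_of_isPisotUnit β
  let I := T.A.biUnion T.intervals
  let J := T.A.biUnion fun a => (T.intervals a).image fun p => (β * p.1 - (a : ℝ), β * p.2 - (a : ℝ))
  have h1 : icoUnion I = ⋃ a ∈ T.A, icoUnion (T.intervals a) := by
    simp only [I, icoUnion, Finset.set_biUnion_biUnion]
  have h2 : iocUnion I = ⋃ a ∈ T.A, iocUnion (T.intervals a) := by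
    simp only [I, iocUnion, Finset.set_biUnion_biUnion]
  have h3 : icoUnion J = ⋃ a ∈ T.A, (fun x : ℝ => β * x - (a : ℝ)) '' icoUnion (T.intervals a) := by
    ext x
    simp only [mem_icoUnion, J, Finset.mem_biUnion, Finset.mem_image, Set.mem_iUnion, Set.mem_image,
      exists_prop]
    constructor
    · rintro ⟨_, ⟨a, ha, p, hp, rfl⟩, h1, h2⟩
      refine ⟨a, ha, (x + a) / β, ⟨p, hp, ?_, ?_⟩, ?_⟩
      · rw [le_div_iff₀ hβ]; dsimp only at h1; linarith
      · rw [div_lt_iff₀ hβ]; dsimp only at h2; linarith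
      · field_simp; ring
    · rintro ⟨a, ha, y, ⟨p, hp, h1, h2⟩, rfl⟩
      refine ⟨_, ⟨a, ha, p, hp, rfl⟩, ?_, ?_⟩ <;> dsimp only <;> gcongr
  have h4 : iocUnion J = ⋃ a ∈ T.A, (fun x : ℝ => β * x - (a : ℝ)) '' iocUnion (T.intervals a) := by
    ext x
    simp only [mem_iocUnion, J, Finset.mem_biUnion, Finset.mem_image, Set.mem_iUnion, Set.mem_image,
      exists_prop]
    constructor
    · rintro ⟨_, ⟨a, ha, p, hp, rfl⟩, h1, h2⟩
      refine ⟨a, ha, (x + a) / β, ⟨p, hp, ?_, ?_⟩, ?_⟩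
      · rw [lt_div_iff₀ hβ]; dsimp only at h1; linarith
      · rw [div_le_iff₀ hβ]; dsimp only at h2; linarith
      · field_simp; ring
    · rintro ⟨a, ha, y, ⟨p, hp, h1, h2⟩, rfl⟩
      refine ⟨_, ⟨a, ha, p, hp, rfl⟩, ?_, ?_⟩ <;> dsimp only <;> gcongr
  rw [← h4, ← h2]
  apply iocUnion_congr
  rw [h3, h1, T.image_eq]

/-- Reflection turns `(ℓ, r]` into `[-r, -ℓ)`, so everything proved for right-continuous
transformations also applies to `T̃`. -/
theorem exists_isReflection : ∃ T' : Transf β, IsReflection T T' := by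
  classical
  let ng : ℝ × ℝ → ℝ × ℝ := fun p => (-p.2, -p.1)
  have hng : ∀ p, ng (ng p) = p := fun p => by simp [ng]
  let A' : Finset ℚ⟮β⟯ := T.A.image Neg.neg
  let I' : ℚ⟮β⟯ → Finset (ℝ × ℝ) := fun a => (T.intervals (-a)).image ng
  have hA' : ∀ a, a ∈ A' ↔ -a ∈ T.A := fun a => by
    simp only [A', Finset.mem_image]
    exact ⟨by rintro ⟨b, hb, rfl⟩; rwa [neg_neg], fun h => ⟨_, h, neg_neg a⟩⟩
  have hI' : ∀ a x, x ∈ icoUnion (I' a) ↔ -x ∈ iocUnion (T.intervals (-a)) := fun a x => by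
    rw [mem_icoUnion, mem_iocUnion]
    simp only [I', Finset.mem_image]
    constructor
    · rintro ⟨_, ⟨p, hp, rfl⟩, h1, h2⟩
      simp only [ng] at h1 h2
      exact ⟨p, hp, by linarith, by linarith⟩
    · rintro ⟨p, hp, h1, h2⟩
      refine ⟨_, ⟨p, hp, rfl⟩, ?_, ?_⟩ <;> simp only [ng] <;> linarith
  have himg := T.imageL_eq
  refine ⟨⟨A', I', T.A_nonempty.image _, fun a ha => ?_, fun a ha a' ha' hne => ?_, ?_⟩, ?_, ?_⟩
  · obtain ⟨x, hx⟩ := T.piece_nonempty _ ((hA' a).mp ha)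
    obtain ⟨p, hp, h1, h2⟩ := mem_icoUnion.mp hx
    refine ⟨-p.2, (hI' a _).mpr ?_⟩
    rw [neg_neg]
    exact mem_iocUnion.mpr ⟨p, hp, h1.trans_lt h2, le_rfl⟩
  · rw [Set.disjoint_left]
    intro x hx hx'
    rw [hI', mem_iocUnion_iff_eventually] at hx hx'
    obtain ⟨y, hy, hy'⟩ := (hx.and hx').exists
    exact Set.disjoint_left.mp (T.piece_disjoint _ ((hA' a).mp ha) _ ((hA' a').mp ha')
      (fun h => hne (neg_injective h))) hy hy'
  · have e1 : ∀ x, x ∈ ⋃ a ∈ A', (fun x : ℝ => β * x - (a : ℝ)) '' icoUnion (I' a) ↔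
        -x ∈ ⋃ a ∈ T.A, (fun x : ℝ => β * x - (a : ℝ)) '' iocUnion (T.intervals a) := by
      intro x
      simp only [Set.mem_iUnion, Set.mem_image, exists_prop]
      constructor
      · rintro ⟨a, ha, y, hy, rfl⟩
        refine ⟨-a, (hA' a).mp ha, -y, (hI' a y).mp hy, ?_⟩
        push_cast; ring
      · rintro ⟨a, ha, y, hy, h⟩
        refine ⟨-a, (hA' _).mpr (by rwa [neg_neg]), -y, (hI' _ _).mpr (by rwa [neg_neg, neg_neg]), ?_⟩
        push_cast
        linarith
    have e2 : ∀ x, x ∈ ⋃ a ∈ A', icoUnion (I' a) ↔ -x ∈ ⋃ a ∈ T.A, iocUnion (T.intervals a) := by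
      intro x
      simp only [Set.mem_iUnion, exists_prop]
      constructor
      · rintro ⟨a, ha, hx⟩
        exact ⟨-a, (hA' a).mp ha, (hI' a x).mp hx⟩
      · rintro ⟨a, ha, hx⟩
        exact ⟨-a, (hA' _).mpr (by rwa [neg_neg]), (hI' _ _).mpr (by rwa [neg_neg])⟩
    ext x
    rw [e1, e2, himg]
  · intro a
    rw [hA', neg_neg]
  · intro a p
    simp only [I', Finset.mem_image, neg_neg]
    constructor
    · intro hp; exact ⟨p, hp, rfl⟩
    · rintro ⟨q, hq, h⟩
      have : q = p := by rw [← hng q, h]; exact hng p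
      rwa [← this]

end Existence

/-! ### Tiles at regular points -/

section Matching

variable {β : ℝ} [IsPisotUnit β] {T T' : Transf β}

/-- A backward orbit of a regular point visits `X ∩ X̃` infinitely often. -/
theorem IsReflection.exists_neg_backPt_mem (h : IsReflection T T') {z : ℝ} (hz : z ∈ T.domain)
    (hz' : -z ∈ T'.domain) {w : ℕ → ℚ⟮β⟯} (hw : T.IsPast z w) (N : ℕ) :
    ∃ n ≥ N, -backPt β z w n ∈ T'.domain := by
  by_contra hc
  push Not at hc
  have hmem : ∀ n, backPt β z w n ∈ T.domain := fun n => (hw.isWord n).backPt_mem hz le_rfl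
  -- Points of `X \ X̃` are among the finitely many left end points; a backward orbit that stays
  -- there from `N` on repeats itself.
  obtain ⟨i, j, hij, heq⟩ := Finite.exists_ne_map_eq_of_infinite
    (fun i : ℕ => (⟨backPt β z w (N + i), h.mem_leftEnds (hmem _) (hc _ (by omega))⟩ : T.leftEnds))
  have heq' : backPt β z w (N + i) = backPt β z w (N + j) := congrArg Subtype.val heq
  obtain ⟨m, n, hm, hmn, he⟩ : ∃ m n, N ≤ m ∧ m < n ∧ backPt β z w m = backPt β z w n := by
    rcases lt_or_gt_of_ne hij with hlt | hlt
    · exact ⟨N + i, N + j, by omega, by omega, heq'⟩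
    · exact ⟨N + j, N + i, by omega, by omega, heq'.symm⟩
  have hit : ∀ a b, T.map^[b] (backPt β z w (a + b)) = backPt β z w a :=
    fun a b => (hw.isWord (a + b)).iterate_backPt le_rfl
  have hper : Function.IsPeriodicPt T.map (n - m) (backPt β z w m) := by
    have := hit m (n - m)
    rw [Nat.add_sub_cancel' hmn.le, ← he] at this
    exact this
  have h1 := hper.iterate_mod_apply m
  have h2 := hit 0 m
  rw [zero_add] at h2
  rw [h2, he] at h1
  have hlt := Nat.mod_lt m (Nat.sub_pos_of_lt hmn)
  -- The point `z` lies on the resulting cycle, so it occurs again as the backward point with index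
  -- `n - m % (n - m) > m ≥ N`, against the assumption that no such point lies in `X̃`.
  have h3 := hit (n - m % (n - m)) (m % (n - m))
  rw [Nat.sub_add_cancel (by omega), h1] at h3
  exact hc (n - m % (n - m)) (by omega) (by rw [← h3]; exact hz')

/-- Take a far backward point `y` of `z` in `X ∩ X̃`. By regularity the `T̃`-orbit of `y` also
arrives at `z` after the same `n` steps, so its digits form a word with the same value. The two
points of the tiles then differ by `O(ρ^n)`, and tiles are closed. -/
theorem IsReflection.neg_mem_prototile (h : IsReflection T T') {z : ℝ} (hz : IsRegularPt T T' z)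
    {p : hyperplane β} (hp : p ∈ T.prototile z) : -p ∈ T'.prototile (-z) := by
  obtain ⟨w, hw, rfl⟩ := exists_isPast_of_mem_prototile hz.mem hp
  obtain ⟨C, hC0, hC⟩ := exists_norm_phiSeq_sub_le (β := β) T'.A
  rw [← (prototile_isCompact hz.neg_mem).isClosed.closure_eq, Metric.mem_closure_iff]
  intro ε hε
  have htend := (tendsto_pow_atTop_nhds_zero_of_lt_one (rate_pos (β := β)).le rate_lt_one).const_mul C
  rw [mul_zero] at htend
  obtain ⟨N, hN⟩ := eventually_atTop.mp (htend.eventually (gt_mem_nhds hε))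
  obtain ⟨n, hn, hy'⟩ := h.exists_neg_backPt_mem hz.mem hz.neg_mem hw N
  set y := backPt β z w n with hy
  have hyT : y ∈ T.domain := (hw.isWord n).backPt_mem hz.mem le_rfl
  have hyn : T.map^[n] y = z := by
    have := (hw.isWord (0 + n)).iterate_backPt (k := n) (n := 0) le_rfl
    rwa [zero_add] at this
  have hyn' : T'.map^[n] (-y) = -z := by
    -- Let `j` be the last time up to `n` at which the orbits agree. If `j < n`, the orbits of `T^j
    -- y` would reach `z` before meeting again, which regularity forbids.
    let P : ℕ → Prop := fun j => T'.map^[j] (-y) = -T.map^[j] y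
    classical
    set j := Nat.findGreatest P n with hj
    have hjP : P j := Nat.findGreatest_spec (P := P) (Nat.zero_le n) rfl
    have hjn : j ≤ n := Nat.findGreatest_le n
    rcases hjn.eq_or_lt with he | hlt
    · rw [he] at hjP
      rw [← hyn]; exact hjP
    · exfalso
      refine (hz.iterate_ne (T.map^[j] y) (iterate_map_mem hyT j) ?_ (n - j) (by omega) ?_).1 ?_
      · rw [← show T'.map^[j] (-y) = -T.map^[j] y from hjP]
        exact iterate_map_mem hy' j
      · intro i hi1 hi2 hc
        refine Nat.findGreatest_is_greatest (P := P) (n := n) (k := i + j) (by omega) (by omega) ?_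
        change T'.map^[i + j] (-y) = -T.map^[i + j] y
        rw [Function.iterate_add_apply, Function.iterate_add_apply,
          show T'.map^[j] (-y) = -T.map^[j] y from hjP, hc]
      · rw [← Function.iterate_add_apply, Nat.sub_add_cancel hjn, hyn]
  obtain ⟨h1, h2⟩ := isWord_digits hy' n
  have h3 := h2 n le_rfl
  rw [hyn'] at h1 h3
  rw [Nat.sub_self, Function.iterate_zero_apply] at h3
  obtain ⟨w', hw', hagree⟩ := h1.exists_isPast hz.neg_mem
  refine ⟨_, hw'.mem_prototile hz.neg_mem, ?_⟩
  rw [dist_eq_norm, ← phiSeq_neg]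
  refine (hC _ _ n (fun i => (h.mem_A _).mp (hw i).1) (fun i => (hw' i).1) ?_).trans_lt (hN n hn)
  -- Both words have length `n` and lead from `y` to `z`, which determines their value in `ℝ`, hence
  -- in `ℚ(β)`.
  apply Subtype.coe_injective
  have e1 := sum_word_coe (-z) w' n
  have e2 := sum_word_coe (-z) (fun i => -w i) n
  change ((_ : ℚ⟮β⟯) : ℝ) = ((_ : ℚ⟮β⟯) : ℝ)
  rw [e1, e2, backPt_neg, backPt_congr hagree, h3]

/-- Words can be moved to the right up to the next image of an end point. -/
theorem IsReflection.isWord_neg (h : IsReflection T T') {x z : ℝ} (hxz : x < z) {N : ℕ}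
    {w : ℕ → ℚ⟮β⟯} (hw : T.IsWord x N w)
    (hb : ∀ l ∈ T'.leftEnds, ∀ j ≤ N, -T'.map^[j] l ∉ Set.Ioo x z) :
    T'.IsWord (-z) N (fun i => -w i) := by
  -- The points between the two backward orbits stay in the interval of the word. Otherwise a right
  -- end point `p.2` would lie between them, and its image of order `m + 1` under the
  -- left-continuous map would fall into `(x, z)`, against `hb`.
  have key : ∀ n ≤ N, ∀ m < n, ∀ s ∈ Set.Ioc (backPt β x w (m + 1)) (backPt β z w (m + 1)),
      -s ∈ T'.piece (-w m) := by
    intro n hn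
    induction n with
    | zero => intro m hm; omega
    | succ n ih =>
      have ih := ih (by omega)
      intro m hm
      rcases Nat.lt_succ_iff_lt_or_eq.mp hm with hlt | rfl
      · exact ih m hlt
      obtain ⟨p, hp, hp1, hp2⟩ := mem_icoUnion.mp (hw m (by omega)).2
      have hit : ∀ k ≤ m, ∀ s ∈ Set.Ioo (backPt β x w k) (backPt β z w k),
          -T'.map^[k] (-s) ∈ Set.Ioo x z := by
        intro k
        induction k with
        | zero => intro _ s hs; simpa [backPt] using hs
        | succ k ihk =>
          intro hk s hs
          have hs' := ih k (by omega) s ⟨hs.1, hs.2.le⟩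
          have hmap : T'.map (-s) = -(β * s - w k) := by
            rw [map_eq ((h.mem_A _).mp (hw k (by omega)).1) hs']
            push_cast; ring
          rw [Function.iterate_succ_apply, hmap]
          refine ihk (by omega) _ ?_
          have hβ := pos_of_isPisotUnit β
          rw [← mul_backPt_succ x w k, ← mul_backPt_succ z w k]
          constructor
          · have := mul_lt_mul_of_pos_left hs.1 hβ; linarith
          · have := mul_lt_mul_of_pos_left hs.2 hβ; linarith
      have hle : backPt β z w (m + 1) ≤ p.2 := by
        by_contra hlt
        rw [not_le] at hlt
        have hA := (h.mem_A _).mp (hw m (by omega)).1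
        have hI := (h.mem_intervals _ _).mp hp
        have hpiece : -p.2 ∈ T'.piece (-w m) :=
          h.neg_mem_piece.mpr (mem_iocUnion.mpr ⟨p, hp, hp1.trans_lt hp2, le_rfl⟩)
        refine hb (-p.2) (fst_mem_leftEnds hA hI) (m + 1) (by omega) ?_
        have hmap : T'.map (-p.2) = -(β * p.2 - w m) := by
          rw [map_eq hA hpiece]
          push_cast; ring
        rw [Function.iterate_succ_apply, hmap]
        refine hit m le_rfl _ ?_
        have hβ := pos_of_isPisotUnit β
        rw [← mul_backPt_succ x w m, ← mul_backPt_succ z w m]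
        constructor
        · have := mul_lt_mul_of_pos_left hp2 hβ; linarith
        · have := mul_lt_mul_of_pos_left hlt hβ; linarith
      intro s hs
      exact h.neg_mem_piece.mpr
        (mem_iocUnion.mpr ⟨p, hp, hp1.trans_lt hs.1, hs.2.trans hle⟩)
  intro n hn
  rw [backPt_neg]
  exact ⟨(h.mem_A _).mp (hw n hn).1, key N le_rfl n hn _ ⟨backPt_lt hxz _ _, le_rfl⟩⟩

/-- Induction on the number of obstacles in `(x, x')`. Move the word for `T` to the leftmost
obstacle `z` as a word for `T'`, at the cost `C ρ^N`; since `z` is regular, the point of the tile of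
`T'` there is again one of `T`, and the remaining interval has fewer obstacles. -/
theorem IsReflection.exists_mem_prototile_of_card_le (h : IsReflection T T') {C : ℝ}
    (hC : ∀ (w w' : ℕ → ℚ⟮β⟯) (N : ℕ), (∀ n, w n ∈ T'.A) → (∀ n, w' n ∈ T'.A) →
      ∑ i ∈ Finset.range N, w i * gen β ^ i = ∑ i ∈ Finset.range N, w' i * gen β ^ i →
      ‖phiSeq β w - phiSeq β w'‖ ≤ C * rate β ^ N)
    {N : ℕ} {F : Finset ℝ} (hF : ∀ l ∈ T'.leftEnds, ∀ j ≤ N, -T'.map^[j] l ∈ F) {x' : ℝ}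
    (hx' : -x' ∈ T'.domain) (n : ℕ) : ∀ x ∈ T.domain, x < x' →
      (∀ z ∈ Set.Ioo x x', IsRegularPt T T' z) → (F.filter fun z => z ∈ Set.Ioo x x').card ≤ n →
      ∀ p ∈ T.prototile x, ∃ q ∈ T'.prototile (-x'), ‖p + q‖ ≤ (n + 1) * (C * rate β ^ N) := by
  have step : ∀ x ∈ T.domain, ∀ z, x < z → -z ∈ T'.domain → (∀ y ∈ F, y ∉ Set.Ioo x z) →
      ∀ p ∈ T.prototile x, ∃ q ∈ T'.prototile (-z), ‖p + q‖ ≤ C * rate β ^ N := by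
    intro x hx z hxz hz hz2 p hp
    obtain ⟨w, hw, rfl⟩ := exists_isPast_of_mem_prototile hx hp
    obtain ⟨w', hw', hagree⟩ := (h.isWord_neg hxz (hw.isWord N) fun l hl j hj =>
      hz2 _ (hF l hl j hj)).exists_isPast hz
    refine ⟨_, hw'.mem_prototile hz, ?_⟩
    have := hC (fun i => -w i) w' N (fun n => (h.mem_A _).mp (hw n).1) (fun n => (hw' n).1)
      (Finset.sum_congr rfl fun i hi => by rw [hagree i (Finset.mem_range.mp hi)])
    rwa [phiSeq_neg, ← norm_neg, neg_sub, sub_neg_eq_add, add_comm] at this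
  have hC0 : 0 ≤ C * rate β ^ N := by
    obtain ⟨w, hw⟩ := Transf.exists_isPast hx'
    exact (norm_nonneg _).trans (hC w w N (fun n => (hw n).1) (fun n => (hw n).1) rfl)
  induction n with
  | zero =>
    intro x hx hxx' _ hcard p hp
    have hempty := Finset.card_eq_zero.mp (Nat.le_zero.mp hcard)
    obtain ⟨q, hq, hpq⟩ := step x hx x' hxx' hx'
      (fun y hy hc => (Finset.eq_empty_iff_forall_notMem.mp hempty) y
        (Finset.mem_filter.mpr ⟨hy, hc⟩)) p hp
    exact ⟨q, hq, by simpa using hpq⟩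
  | succ n ih =>
    intro x hx hxx' hreg hcard p hp
    rcases (F.filter fun z => z ∈ Set.Ioo x x').eq_empty_or_nonempty with hempty | hne
    · obtain ⟨q, hq, hpq⟩ := step x hx x' hxx' hx'
        (fun y hy hc => (Finset.eq_empty_iff_forall_notMem.mp hempty) y
          (Finset.mem_filter.mpr ⟨hy, hc⟩)) p hp
      refine ⟨q, hq, hpq.trans (le_mul_of_one_le_left hC0 ?_)⟩
      push_cast; linarith [n.cast_nonneg (α := ℝ)]
    · set z := (F.filter fun z => z ∈ Set.Ioo x x').min' hne with hz
      have hzm := Finset.min'_mem _ hne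
      rw [← hz] at hzm
      obtain ⟨hzF, hzI⟩ := Finset.mem_filter.mp hzm
      have hzreg := hreg z hzI
      obtain ⟨q₁, hq₁, hpq₁⟩ := step x hx z hzI.1 hzreg.neg_mem (fun y hy hc => by
        have hyF : y ∈ F.filter fun z => z ∈ Set.Ioo x x' :=
          Finset.mem_filter.mpr ⟨hy, hc.1, hc.2.trans hzI.2⟩
        exact (hc.2.trans_le (Finset.min'_le _ y hyF)).false) p hp
      have hq₁' := h.symm.neg_mem_prototile hzreg.symm hq₁
      rw [neg_neg] at hq₁'
      obtain ⟨q, hq, hpq⟩ := ih z hzreg.mem hzI.2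
        (fun y hy => hreg y ⟨hzI.1.trans hy.1, hy.2⟩) (by
          have hss : (F.filter fun y => y ∈ Set.Ioo z x') ⊆
              (F.filter fun y => y ∈ Set.Ioo x x').erase z := by
            intro y hy
            obtain ⟨hy1, hy2⟩ := Finset.mem_filter.mp hy
            exact Finset.mem_erase.mpr ⟨hy2.1.ne', Finset.mem_filter.mpr
              ⟨hy1, hzI.1.trans hy2.1, hy2.2⟩⟩
          have h1 := Finset.card_le_card hss
          rw [Finset.card_erase_of_mem hzm] at h1
          omega) _ hq₁'
      refine ⟨q, hq, ?_⟩
      have e : p + q = (p + q₁) + (-q₁ + q) := by abel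
      rw [e]
      refine (norm_add_le _ _).trans ((add_le_add hpq₁ hpq).trans (le_of_eq ?_))
      push_cast; ring

/-- The obstacles for words of length `N` are the images of order at most `N` of the left end points
of `T'`, at most `(N + 1) E` in number. The total error is `O(N ρ^N)`, and the tile is closed. -/
theorem IsReflection.neg_mem_prototile_of_lt (h : IsReflection T T') {x x' : ℝ} (hxx' : x < x')
    (hx : x ∈ T.domain) (hx' : -x' ∈ T'.domain) (hreg : ∀ z ∈ Set.Ioo x x', IsRegularPt T T' z)
    {p : hyperplane β} (hp : p ∈ T.prototile x) : -p ∈ T'.prototile (-x') := by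
  classical
  obtain ⟨C, hC0, hC⟩ := exists_norm_phiSeq_sub_le (β := β) T'.A
  rw [← (prototile_isCompact hx').isClosed.closure_eq, Metric.mem_closure_iff]
  intro ε hε
  set E := T'.leftEnds.card with hE
  have htend : Tendsto (fun N : ℕ => (((N + 1) * E + 1 : ℕ) : ℝ) * (C * rate β ^ N))
      atTop (𝓝 0) := by
    have hρ : |rate β| < 1 := by rw [abs_of_pos rate_pos]; exact rate_lt_one
    have h1 := tendsto_pow_const_mul_const_pow_of_abs_lt_one 1 hρ
    have h2 := tendsto_pow_const_mul_const_pow_of_abs_lt_one 0 hρ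
    have h3 := (h1.const_mul (E * C)).add (h2.const_mul ((E + 1) * C))
    simp only [mul_zero, add_zero] at h3
    refine h3.congr fun N => ?_
    push_cast; ring
  obtain ⟨N, hN⟩ := (htend.eventually (gt_mem_nhds hε)).exists
  set F : Finset ℝ := ((Finset.range (N + 1)) ×ˢ T'.leftEnds).image
    fun q => -T'.map^[q.1] q.2 with hF
  have hFcard : F.card ≤ (N + 1) * E := by
    refine Finset.card_image_le.trans (le_of_eq ?_)
    rw [Finset.card_product, Finset.card_range]
  obtain ⟨q, hq, hpq⟩ := h.exists_mem_prototile_of_card_le hC (N := N) (F := F)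
    (fun l hl j hj => Finset.mem_image.mpr ⟨(j, l), Finset.mem_product.mpr
      ⟨Finset.mem_range.mpr (by omega), hl⟩, rfl⟩) hx' ((N + 1) * E) x hx hxx' hreg
    ((Finset.card_filter_le _ _).trans hFcard) p hp
  refine ⟨q, hq, ?_⟩
  rw [dist_eq_norm, ← norm_neg, neg_sub, sub_neg_eq_add, add_comm]
  refine hpq.trans_lt ?_
  exact_mod_cast hN

/-- The prototile of `x` does not change as long as `x` meets no point of `𝒱`. -/
theorem prototile_eq_of_lt {x x' : ℝ} (hxx' : x < x') (hx : x ∈ T.domain)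
    (hV : ∀ z ∈ Set.Ioc x x', z ∈ T.domain \ T.V) : T.prototile x = T.prototile x' := by
  obtain ⟨T', h⟩ := T.exists_isReflection
  have hreg : ∀ z ∈ Set.Ioc x x', IsRegularPt T T' z := fun z hz => h.isRegularPt (hV z hz).1 (hV z hz).2
  have hreg' := hreg x' ⟨hxx', le_rfl⟩
  ext p
  constructor
  · intro hp
    have h1 := h.neg_mem_prototile_of_lt hxx' hx hreg'.neg_mem
      (fun z hz => hreg z ⟨hz.1, hz.2.le⟩) hp
    simpa using h.symm.neg_mem_prototile hreg'.symm h1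
  -- The converse changes to `T'` at `x'` and moves to the right from `-x'` to `-x`.
  · intro hp
    have h1 := h.neg_mem_prototile hreg' hp
    have h2 := h.symm.neg_mem_prototile_of_lt (neg_lt_neg hxx') hreg'.neg_mem
      (by rwa [neg_neg]) (fun z hz => by
        have := (hreg (-z) ⟨by linarith [hz.2], by linarith [hz.1]⟩).symm
        rwa [neg_neg] at this) h1
    simpa using h2

end Matching

end Transf

namespace Transf

/-! ### The prototiles -/

section Prototiles

variable {β : ℝ} {T : Transf β}

theorem exists_Ico_subset_domain (T : Transf β) : ∃ l r : ℝ, l < r ∧ Set.Ico l r ⊆ T.domain := by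
  obtain ⟨a, ha⟩ := T.A_nonempty
  obtain ⟨x, hx⟩ := T.piece_nonempty a ha
  obtain ⟨p, hp, h1, h2⟩ := mem_icoUnion.mp hx
  exact ⟨p.1, p.2, h1.trans_lt h2, fun y hy => mem_domain ha (mem_icoUnion.mpr ⟨p, hp, hy⟩)⟩

/-- Intervals `[ℓ, r)` have complements that are open to the right. -/
theorem eventually_notMem_domain {x : ℝ} (hx : x ∉ T.domain) : ∀ᶠ y in 𝓝[≥] x, y ∉ T.domain := by
  have h : ∀ᶠ y in 𝓝[≥] x, ∀ a ∈ T.A, ∀ p ∈ T.intervals a, ¬(p.1 ≤ y ∧ y < p.2) := by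
    rw [Filter.eventually_all_finset]
    intro a ha
    rw [Filter.eventually_all_finset]
    intro p hp
    rcases lt_or_ge x p.1 with h1 | h1
    · filter_upwards [Ico_mem_nhdsGE h1] with y hy hc
      exact hy.2.not_ge hc.1
    · filter_upwards [self_mem_nhdsWithin] with y hy hc
      exact hx (mem_domain ha (mem_icoUnion.mpr ⟨p, hp, h1, lt_of_le_of_lt hy hc.2⟩))
  filter_upwards [h] with y hy hc
  obtain ⟨a, ha, hya⟩ := exists_of_mem_domain hc
  obtain ⟨p, hp, hyp⟩ := mem_icoUnion.mp hya
  exact hy a ha p hp hyp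

/-- The element of `ℤ[β] ∩ X` that corresponds to `T x`. -/
def next (T : Transf β) (x : ℚ⟮β⟯) : ℚ⟮β⟯ := gen β * x - T.digit (x : ℝ)

theorem next_coe (x : ℚ⟮β⟯) : (T.next x : ℝ) = T.map (x : ℝ) := by
  rw [next, map]; push_cast; rw [gen_coe]

theorem next_mem (hA : ∀ a ∈ T.A, a ∈ ringZ β) {x : ℚ⟮β⟯} (hx : x ∈ T.tileIndex) :
    T.next x ∈ T.tileIndex := by
  refine ⟨Subalgebra.sub_mem _ (Subalgebra.mul_mem _ gen_mem hx.1) (hA _ (digit_mem hx.2)), ?_⟩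
  rw [next_coe]
  exact map_mem hx.2

variable [IsPisotUnit β]

/-- On one interval `[ℓ, r)` the set `𝒟_x` depends only on which points of `𝒱` are at most `x`. -/
theorem finite_prototiles (hV : T.V.Finite) : (T.prototile '' T.domain).Finite := by
  classical
  have h : ∀ a ∈ T.A, ∀ p ∈ T.intervals a, (T.prototile '' Set.Ico p.1 p.2).Finite := by
    intro a ha p hp
    have hsub : T.prototile '' Set.Ico p.1 p.2 ⊆ ⋃ s ∈ hV.toFinset.powerset,
        T.prototile '' {x | x ∈ Set.Ico p.1 p.2 ∧ (hV.toFinset.filter fun z => z ≤ x) = s} := by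
      rintro _ ⟨x, hx, rfl⟩
      exact Set.mem_biUnion (Finset.mem_powerset.mpr (Finset.filter_subset _ _)) ⟨x, ⟨hx, rfl⟩, rfl⟩
    refine ((Finset.finite_toSet _).biUnion fun s _ => Set.Subsingleton.finite ?_).subset hsub
    have key : ∀ x ∈ Set.Ico p.1 p.2, ∀ y ∈ Set.Ico p.1 p.2, x < y →
        (hV.toFinset.filter fun z => z ≤ x) = (hV.toFinset.filter fun z => z ≤ y) →
        T.prototile x = T.prototile y := by
      intro x hx y hy hxy he
      refine prototile_eq_of_lt hxy (mem_domain ha (mem_icoUnion.mpr ⟨p, hp, hx⟩)) fun z hz =>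
        ⟨mem_domain ha (mem_icoUnion.mpr ⟨p, hp, hx.1.trans hz.1.le, hz.2.trans_lt hy.2⟩),
          fun hzV => ?_⟩
      have : z ∈ hV.toFinset.filter fun z => z ≤ y :=
        Finset.mem_filter.mpr ⟨hV.mem_toFinset.mpr hzV, hz.2⟩
      rw [← he] at this
      exact (Finset.mem_filter.mp this).2.not_gt hz.1
    rintro _ ⟨x, ⟨hx, hxs⟩, rfl⟩ _ ⟨y, ⟨hy, hys⟩, rfl⟩
    rcases lt_trichotomy x y with hlt | rfl | hlt
    · exact key x hx y hy hlt (hxs.trans hys.symm)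
    · rfl
    · exact (key y hy x hx hlt (hys.trans hxs.symm)).symm
  refine (T.A.finite_toSet.biUnion fun a ha => (T.intervals a).finite_toSet.biUnion (h a ha)).subset ?_
  rintro _ ⟨x, hx, rfl⟩
  obtain ⟨a, ha, hxa⟩ := exists_of_mem_domain hx
  obtain ⟨p, hp, hxp⟩ := mem_icoUnion.mp hxa
  exact Set.mem_biUnion ha (Set.mem_biUnion hp ⟨x, hxp, rfl⟩)

theorem eventually_prototile_eq (hV : T.V.Finite) {x : ℝ} (hx : x ∈ T.domain) :
    ∀ᶠ y in 𝓝[≥] x, y ∈ T.domain ∧ T.prototile y = T.prototile x := by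
  obtain ⟨a, ha, hxa⟩ := exists_of_mem_domain hx
  obtain ⟨p, hp, hxp⟩ := mem_icoUnion.mp hxa
  have hdom : ∀ y ∈ Set.Ico x p.2, y ∈ T.domain := fun y hy =>
    mem_domain ha (mem_icoUnion.mpr ⟨p, hp, hxp.1.trans hy.1, hy.2⟩)
  have hW : (T.V ∩ Set.Ioi x)ᶜ ∈ 𝓝[≥] x :=
    mem_nhdsWithin_of_mem_nhds ((hV.inter_of_left _).isClosed.isOpen_compl.mem_nhds fun h =>
      lt_irrefl x h.2)
  obtain ⟨u, hu, hsub⟩ := mem_nhdsGE_iff_exists_Ico_subset.mp hW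
  filter_upwards [Ico_mem_nhdsGE hxp.2, Ico_mem_nhdsGE hu] with y hy1 hy2
  refine ⟨hdom y hy1, ?_⟩
  rcases hy1.1.eq_or_lt with rfl | hlt
  · rfl
  · exact (prototile_eq_of_lt hlt hx fun z hz => ⟨hdom z ⟨hz.1.le, hz.2.trans_lt hy1.2⟩, fun hzV =>
      hsub ⟨hz.1.le, hz.2.trans_lt hy2.2⟩ ⟨hzV, hz.1⟩⟩).symm

end Prototiles

/-! ### The tiles -/

section Tiles

variable {β : ℝ} [IsPisotUnit β] {T : Transf β}

/-- The tile `𝒯_x = Φ(x) + 𝒟_x`. -/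
def tile (T : Transf β) (x : ℚ⟮β⟯) : Set (hyperplane β) :=
  (fun z => Phi β x + z) '' T.prototile (x : ℝ)

theorem mem_tile {x : ℚ⟮β⟯} {p : hyperplane β} :
    p ∈ T.tile x ↔ p - Phi β x ∈ T.prototile (x : ℝ) := by
  constructor
  · rintro ⟨z, hz, rfl⟩
    simpa using hz
  · intro h
    exact ⟨_, h, by simp⟩

theorem tile_eq_image (x : ℚ⟮β⟯) :
    T.tile x = Homeomorph.addLeft (Phi β x) '' T.prototile (x : ℝ) := rfl

theorem tile_isClosed {x : ℚ⟮β⟯} (hx : x ∈ T.tileIndex) : IsClosed (T.tile x) := by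
  rw [tile_eq_image, (Homeomorph.addLeft (Phi β x)).isClosed_image]
  exact (prototile_isCompact hx.2).isClosed

theorem interior_tile_nonempty {x : ℚ⟮β⟯} :
    (interior (T.tile x)).Nonempty ↔ (interior (T.prototile (x : ℝ))).Nonempty := by
  rw [tile_eq_image, ← Homeomorph.image_interior, Set.image_nonempty]

theorem mulMap_mem_tile {x : ℚ⟮β⟯} (hx : x ∈ T.tileIndex) {p : hyperplane β}
    (hp : p ∈ T.tile x) : mulMap (gen β) p ∈ T.tile (T.next x) := by
  rw [mem_tile] at hp ⊢
  rw [next_coe]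
  refine (mem_prototile_iff (map_mem hx.2)).mpr ⟨x, hx.2, rfl, _, hp, ?_⟩
  rw [next, map_sub, mulMap_Phi, Phi_sub]
  abel

/-- The subdivision of `𝒟_x` supplies a real preimage `(x + b) / β`; it lies in `ℤ[β]` because `β`
is a unit. -/
theorem exists_next_eq (hA : ∀ a ∈ T.A, a ∈ ringZ β) {x : ℚ⟮β⟯} (hx : x ∈ T.tileIndex)
    {p : hyperplane β} (hp : p ∈ T.tile x) :
    ∃ y ∈ T.tileIndex, T.next y = x ∧ mulMap (gen β)⁻¹ p ∈ T.tile y := by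
  rw [mem_tile] at hp
  obtain ⟨y', hy', hmap, q, hq, hpq⟩ := (mem_prototile_iff hx.2).mp hp
  obtain ⟨y, hyr, rfl⟩ : ∃ y : ℚ⟮β⟯, y ∈ ringZ β ∧ (y : ℝ) = y' := by
    refine ⟨(gen β)⁻¹ * (x + T.digit y'), Subalgebra.mul_mem _ gen_inv_mem
      (Subalgebra.add_mem _ hx.1 (hA _ (digit_mem hy'))), ?_⟩
    push_cast
    rw [gen_coe, ← hmap, map]
    have := (pos_of_isPisotUnit β).ne'
    field_simp
    ring
  have hnext : T.next y = x := Subtype.coe_injective ((next_coe y).trans hmap)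
  refine ⟨y, ⟨hyr, hy'⟩, hnext, ?_⟩
  have hg := gen_ne_zero β
  rw [mem_tile]
  convert hq using 1
  have hyx : y = (gen β)⁻¹ * (x + T.digit (y : ℝ)) := by
    rw [← hnext, next, sub_add_cancel, inv_mul_cancel_left₀ hg]
  rw [← mulMap_inv_mulMap hg q, ← sub_eq_of_eq_add' hpq, map_sub, map_sub, mulMap_Phi, mulMap_Phi,
    sub_sub, ← Phi_add, ← mul_add, ← hyx]

theorem exists_subdivision (hA : ∀ a ∈ T.A, a ∈ ringZ β) (n : ℕ) :
    ∀ x ∈ T.tileIndex, ∀ p ∈ T.tile x, ∃ y ∈ T.tileIndex, ∃ q ∈ T.tile y,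
      mulMap (gen β ^ n) q = p ∧ ∀ q' ∈ T.tile y, mulMap (gen β ^ n) q' ∈ T.tile x := by
  induction n with
  | zero =>
    intro x hx p hp
    exact ⟨x, hx, p, hp, by rw [pow_zero, mulMap_one], fun q hq => by rwa [pow_zero, mulMap_one]⟩
  | succ n ih =>
    intro x hx p hp
    obtain ⟨y, hy, q, hq, hqp, hsub⟩ := ih x hx p hp
    obtain ⟨y', hy', hnext, hq'⟩ := exists_next_eq hA hy hq
    refine ⟨y', hy', _, hq', ?_, fun q' hq' => ?_⟩
    · rw [pow_succ, ← mulMap_mulMap, mulMap_mulMap_inv (gen_ne_zero β), hqp]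
    · rw [pow_succ, ← mulMap_mulMap]
      refine hsub _ ?_
      rw [← hnext]
      exact mulMap_mem_tile hy' hq'

theorem finite_tiles_near (T : Transf β) (p : hyperplane β) (r : ℝ) :
    {x | x ∈ T.tileIndex ∧ ∃ q ∈ T.tile x, ‖q - p‖ ≤ r}.Finite := by
  obtain ⟨M, hM⟩ := T.exists_bound
  obtain ⟨M', _, hM'⟩ := T.exists_prototile_bound
  refine (finite_ringZ_bounded M (r + M') p).subset ?_
  rintro x ⟨hx, q, hq, hqp⟩
  refine ⟨hx.1, hM _ hx.2, ?_⟩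
  have e : Phi β x - p = (q - p) - (q - Phi β x) := by abel
  rw [e]
  exact (norm_sub_le _ _).trans (add_le_add hqp (hM' _ hx.2 _ (mem_tile.mp hq)))

theorem locallyFinite_tile (T : Transf β) : LocallyFinite fun x : T.tileIndex => T.tile x := by
  intro p
  refine ⟨Metric.ball p 1, Metric.ball_mem_nhds p one_pos, ?_⟩
  refine Set.Finite.of_finite_image ((finite_tiles_near T p 1).subset ?_)
    Subtype.val_injective.injOn
  rintro _ ⟨x, ⟨q, hq, hqp⟩, rfl⟩
  exact ⟨x.2, q, hq, by rw [← dist_eq_norm]; exact (Metric.mem_ball.mp hqp).le⟩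

/-- The tiles around a point reappear after translation by `Φ(z)` for small `z ≥ 0`. -/
theorem exists_translate_tile (hV : T.V.Finite) (p : hyperplane β) (r : ℝ) :
    ∃ ε > 0, ∀ z ∈ ringZ β, (z : ℝ) ∈ Set.Ico 0 ε → ∀ q, ‖q - p‖ ≤ r → ∀ x ∈ T.tileIndex,
      q + Phi β z ∈ T.tile x → x - z ∈ T.tileIndex ∧ q ∈ T.tile (x - z) ∧
        T.prototile ((x - z : ℚ⟮β⟯) : ℝ) = T.prototile (x : ℝ) := by
  obtain ⟨M, hM⟩ := T.exists_bound
  obtain ⟨M', _, hM'⟩ := T.exists_prototile_bound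
  -- The difference `l = x - z` ranges over a finite set, uniformly in `z < 1`. For each `l` and all
  -- small `z ≥ 0`, `l + z ∈ X` forces `l ∈ X` with the same prototile.
  set L := {l : ℚ⟮β⟯ | l ∈ ringZ β ∧ |(l : ℝ)| ≤ M + 1 ∧ ‖Phi β l - p‖ ≤ r + M'} with hL
  have hLfin : L.Finite := finite_ringZ_bounded _ _ _
  have hev : ∀ᶠ z : ℝ in 𝓝[≥] 0, ∀ l ∈ L, (l : ℝ) + z ∈ T.domain →
      (l : ℝ) ∈ T.domain ∧ T.prototile ((l : ℝ) + z) = T.prototile (l : ℝ) := by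
    rw [Filter.eventually_all_finite hLfin]
    intro l _
    have htend : Tendsto (fun z : ℝ => (l : ℝ) + z) (𝓝[≥] 0) (𝓝[≥] (l : ℝ)) := by
      refine tendsto_nhdsWithin_of_tendsto_nhds_of_eventually_within _ ?_ ?_
      · have : Tendsto (fun z : ℝ => (l : ℝ) + z) (𝓝 0) (𝓝 ((l : ℝ) + 0)) :=
          (continuous_const.add continuous_id).tendsto 0
        rw [add_zero] at this
        exact this.mono_left nhdsWithin_le_nhds
      · filter_upwards [self_mem_nhdsWithin] with z hz
        exact le_add_of_nonneg_right (Set.mem_Ici.mp hz)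
    by_cases hl : (l : ℝ) ∈ T.domain
    · filter_upwards [htend.eventually (eventually_prototile_eq hV hl)] with z hz _
      exact ⟨hl, hz.2⟩
    · filter_upwards [htend.eventually (eventually_notMem_domain hl)] with z hz hc
      exact absurd hc hz
  obtain ⟨u, hu, hsub⟩ := mem_nhdsGE_iff_exists_Ico_subset.mp hev
  refine ⟨min u 1, lt_min hu one_pos, fun z hz hzI q hqp x hx hq => ?_⟩
  have hz1 : (z : ℝ) < 1 := hzI.2.trans_le (min_le_right _ _)
  have hcoe : ((x - z : ℚ⟮β⟯) : ℝ) + (z : ℝ) = x := by push_cast; ring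
  have hq' : q - Phi β (x - z) ∈ T.prototile (x : ℝ) := by
    convert mem_tile.mp hq using 1
    rw [Phi_sub]; abel
  have hl : x - z ∈ L := by
    refine ⟨Subalgebra.sub_mem _ hx.1 hz, ?_, ?_⟩
    · push_cast
      refine (abs_sub _ _).trans (add_le_add (hM _ hx.2) ?_)
      rw [abs_of_nonneg hzI.1]; exact hz1.le
    · have e : Phi β (x - z) - p = (q - p) - (q - Phi β (x - z)) := by abel
      rw [e]
      exact (norm_sub_le _ _).trans (add_le_add hqp (hM' _ hx.2 _ hq'))
  have h := hsub (show (z : ℝ) ∈ Set.Ico 0 u from ⟨hzI.1, hzI.2.trans_le (min_le_left _ _)⟩)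
    (x - z) hl (by rw [hcoe]; exact hx.2)
  rw [hcoe] at h
  exact ⟨⟨hl.1, h.1⟩, mem_tile.mpr (by rw [← h.2]; exact hq'), h.2.symm⟩

/-! ### Covering -/

theorem mulMap_pow_mem_tiles (hA : ∀ a ∈ T.A, a ∈ ringZ β) (n : ℕ) {p : hyperplane β}
    (hp : p ∈ ⋃ x : T.tileIndex, T.tile x) :
    mulMap (gen β ^ n) p ∈ ⋃ x : T.tileIndex, T.tile x := by
  induction n with
  | zero => rwa [pow_zero, mulMap_one]
  | succ n ih =>
    obtain ⟨x, hx⟩ := Set.mem_iUnion.mp ih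
    rw [pow_succ', ← mulMap_mulMap]
    exact Set.mem_iUnion.mpr ⟨⟨_, next_mem hA x.2⟩, mulMap_mem_tile x.2 hx⟩

/-- Every point of `H`, in particular `B^(-n) p`, is within `R + M` of some tile. Applying `B^n`
brings points of the union arbitrarily close to `p`, and the union is closed by local finiteness. -/
theorem exists_mem_tile (hA : ∀ a ∈ T.A, a ∈ ringZ β) (p : hyperplane β) :
    ∃ x : T.tileIndex, p ∈ T.tile x := by
  rw [← Set.mem_iUnion]
  have hcl : IsClosed (⋃ x : T.tileIndex, T.tile x) :=
    (locallyFinite_tile T).isClosed_iUnion fun x => tile_isClosed x.2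
  rw [← hcl.closure_eq, Metric.mem_closure_iff]
  intro ε hε
  obtain ⟨l, r, hlr, hI⟩ := T.exists_Ico_subset_domain
  obtain ⟨R, hR⟩ := exists_ringZ_mem_Ico_near (β := β) hlr
  obtain ⟨M, _, hM⟩ := T.exists_prototile_bound
  obtain ⟨C, hC0, hC⟩ := exists_norm_mulMap_pow_le β
  have htend := ((tendsto_pow_atTop_nhds_zero_of_lt_one (rate_pos (β := β)).le
    rate_lt_one).const_mul C).mul_const (R + M)
  rw [mul_zero, zero_mul] at htend
  obtain ⟨n, hn⟩ := (htend.eventually (gt_mem_nhds hε)).exists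
  have hg := pow_ne_zero n (gen_ne_zero β)
  obtain ⟨x, hx, hxI, hxp⟩ := hR (mulMap (gen β ^ n)⁻¹ p)
  obtain ⟨d, hd⟩ := prototile_nonempty (hI hxI)
  have hmem : Phi β x + d ∈ ⋃ x : T.tileIndex, T.tile x :=
    Set.mem_iUnion.mpr ⟨⟨x, hx, hI hxI⟩, d, hd, rfl⟩
  refine ⟨_, mulMap_pow_mem_tiles hA n hmem, ?_⟩
  rw [dist_comm, dist_eq_norm]
  have e : mulMap (gen β ^ n) (Phi β x + d) - p =
      mulMap (gen β ^ n) (Phi β x - mulMap (gen β ^ n)⁻¹ p + d) := by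
    rw [map_add, map_add, map_sub, mulMap_mulMap_inv hg]
    abel
  rw [e]
  refine (hC n _).trans_lt (lt_of_le_of_lt ?_ hn)
  have := (norm_add_le _ _).trans (add_le_add hxp (hM _ (hI hxI) d hd))
  have := mul_nonneg hC0 (pow_nonneg (rate_pos (β := β)).le n)
  gcongr

end Tiles

end Transf

/-! ### Closed sets with the symmetries of the tiling are null sets -/

/-- A ball around some `p₀` misses `N`. By relative density every `p` is, up to one of finitely many
corrections `u`, of the form `q + Φ(z)` with `q` in this ball, so the translation property gives `u
+ p ∉ N`. Stability of the complement under `B` scales this down to the translations `B^n u → 0`,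
and the criterion for null sets applies. -/
theorem volume_eq_zero_of_translate {β : ℝ} [IsPisotUnit β] {N : Set (hyperplane β)}
    (hN : IsClosed N) (hne : N ≠ Set.univ) (hB : ∀ p ∈ N, mulMap (gen β)⁻¹ p ∈ N)
    (htrans : ∀ (p : hyperplane β) (r : ℝ), ∃ ε > 0, ∀ z ∈ ringZ β, (z : ℝ) ∈ Set.Ico 0 ε →
      ∀ q, ‖q - p‖ ≤ r → q + Phi β z ∈ N → q ∈ N) : volume N = 0 := by
  obtain ⟨p₀, hp₀⟩ := (Set.ne_univ_iff_exists_notMem N).mp hne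
  obtain ⟨r, hr, hball⟩ := Metric.isOpen_iff.mp hN.isOpen_compl p₀ hp₀
  obtain ⟨ε, hε, htr⟩ := htrans p₀ r
  obtain ⟨R, hR⟩ := exists_ringZ_mem_Ico_near (β := β) hε
  obtain ⟨F, _, hF, hcover⟩ :=
    (isCompact_closedBall (0 : hyperplane β) R).finite_cover_balls hr
  have hesc : ∀ p, ∃ u ∈ hF.toFinset, u + p ∉ N := by
    intro p
    obtain ⟨z, hz, hzI, hzp⟩ := hR (p - p₀)
    have hv : Phi β z - (p - p₀) ∈ Metric.closedBall (0 : hyperplane β) R := by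
      rwa [mem_closedBall_zero_iff]
    obtain ⟨u, hu, huv⟩ := Set.mem_iUnion₂.mp (hcover hv)
    refine ⟨u, hF.mem_toFinset.mpr hu, fun hc => ?_⟩
    have hlt : ‖u + p - Phi β z - p₀‖ < r := by
      have e : u + p - Phi β z - p₀ = -(Phi β z - (p - p₀) - u) := by abel
      rw [e, norm_neg]
      exact mem_ball_iff_norm.mp huv
    refine hball (Metric.mem_ball.mpr (by rwa [dist_eq_norm])) (htr z hz hzI _ hlt.le ?_)
    rwa [sub_add_cancel]
  have hBn : ∀ (n : ℕ) (p : hyperplane β), mulMap (gen β ^ n) p ∈ N → p ∈ N := by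
    intro n
    induction n with
    | zero => intro p hp; rwa [pow_zero, mulMap_one] at hp
    | succ n ih =>
      intro p hp
      have := hB _ hp
      rw [pow_succ', ← mulMap_mulMap, mulMap_inv_mulMap (gen_ne_zero β)] at this
      exact ih p this
  refine measure_eq_zero_of_translates_avoid volume hN hF.toFinset
    (fun n u => mulMap (gen β ^ n) u) (fun u _ => tendsto_mulMap_pow u) fun n p _ => ?_
  obtain ⟨u, hu, hup⟩ := hesc (mulMap (gen β ^ n)⁻¹ p)
  refine ⟨u, hu, fun hc => hup (hBn n _ ?_)⟩
  rwa [map_add, mulMap_mulMap_inv (pow_ne_zero n (gen_ne_zero β))]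

namespace Transf

/-! ### Positive measure, interior points and covering degree. -/

section Measure

variable {β : ℝ} [IsPisotUnit β] {T : Transf β}

/-- Fubini for `ℝ × H ≃ ℝ^d`, with uniqueness of Haar measure up to a factor. -/
theorem volume_cylinder_eq_zero {D : Set (hyperplane β)} (hD : volume D = 0) :
    volume {y : Space β | ∃ t : ℝ, ∃ q ∈ D, y = t • vec₁ β - q} = 0 := by
  let f : (ℝ × hyperplane β) →ₗ[ℝ] Space β :=
    (LinearMap.toSpanSingleton ℝ _ (vec₁ β)).coprod (hyperplane β).subtype
  have hf : ∀ t h, f (t, h) = t • vec₁ β + h := fun t h => by simp [f]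
  have hbij : Function.Bijective f := by
    refine ⟨(injective_iff_map_eq_zero f).mpr ?_, fun y => ?_⟩
    · rintro ⟨t, h⟩ h0
      rw [hf] at h0
      have ht := proj₁_smul_add β t h h.2
      have hz : proj₁ β (0 : Space β) = 0 := proj₁_of_mem (hyperplane β).zero_mem
      rw [h0, hz] at ht
      subst ht
      simpa using h0
    · obtain ⟨h, hh, hy⟩ := exists_decomp β y
      exact ⟨(proj₁ β y, ⟨h, hh⟩), by rw [hf]; exact hy.symm⟩
  let L := (LinearEquiv.ofBijective f hbij).toContinuousLinearEquiv
  have hL : ∀ t h, L (t, h) = t • vec₁ β + h := hf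
  let μ : Measure (ℝ × hyperplane β) := (volume : Measure ℝ).prod (volume : Measure (hyperplane β))
  have hμ : (Measure.map L μ).IsAddHaarMeasure := L.isAddHaarMeasure_map μ
  have hset : {y : Space β | ∃ t : ℝ, ∃ q ∈ D, y = t • vec₁ β - q} =
      L '' (Set.univ ×ˢ (Neg.neg ⁻¹' D)) := by
    ext y
    constructor
    · rintro ⟨t, q, hq, rfl⟩
      refine ⟨(t, -q), ⟨trivial, by simpa using hq⟩, ?_⟩
      rw [hL]; simp [sub_eq_add_neg]
    · rintro ⟨⟨t, q⟩, ⟨_, hq⟩, rfl⟩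
      exact ⟨t, -q, hq, by rw [hL]; simp⟩
  rw [hset, Measure.isAddLeftInvariant_eq_smul (volume : Measure (Space β))
    (Measure.map L μ), Measure.smul_apply]
  have h0 : Measure.map L μ
      (L '' (Set.univ ×ˢ (Neg.neg ⁻¹' D))) = 0 := by
    rw [show Measure.map L μ = Measure.map
      L.toHomeomorph.toMeasurableEquiv μ from rfl, MeasurableEquiv.map_apply]
    have : L.toHomeomorph.toMeasurableEquiv ⁻¹' (L '' (Set.univ ×ˢ (Neg.neg ⁻¹' D))) =
        Set.univ ×ˢ (Neg.neg ⁻¹' D) := Set.preimage_image_eq _ L.injective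
    rw [this, Measure.prod_prod, Measure.measure_preimage_neg, hD, mul_zero]
  rw [h0, smul_zero]

/-- To the right of `x` the prototile is constant, so over a short interval `(x, u)` the set `X̂`
lies in the cylinder on `-𝒟_x`. If `𝒟_x` were null, `μ` would vanish on `(x, u)`, which contains
points of its support. -/
theorem volume_prototile_ne_zero (hsupp : T.invMeasure.support = closure T.domain)
    (hV : T.V.Finite) {x : ℝ} (hx : x ∈ T.domain) : volume (T.prototile x) ≠ 0 := by
  intro h0
  obtain ⟨u, hu, hsub⟩ := mem_nhdsGE_iff_exists_Ico_subset.mp (eventually_prototile_eq hV hx)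
  have hmid : (x + u) / 2 ∈ Set.Ioo x u := by
    have : x < u := hu
    constructor <;> linarith
  have hsup : (x + u) / 2 ∈ T.invMeasure.support := by
    rw [hsupp]
    exact subset_closure (hsub ⟨hmid.1.le, hmid.2⟩).1
  have hpos := (Measure.mem_support_iff_forall _).mp hsup _ (isOpen_Ioo.mem_nhds hmid)
  have hcont : Continuous (proj₁ β) := by
    unfold proj₁
    fun_prop
  rw [invMeasure, Measure.map_apply hcont.measurable measurableSet_Ioo,
    Measure.restrict_apply (hcont.measurable measurableSet_Ioo)] at hpos
  refine hpos.ne' (measure_mono_null ?_ (volume_cylinder_eq_zero h0))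
  rintro _ ⟨hy, v, hv, rfl⟩
  obtain ⟨t, ht, htv⟩ := hv.2 1
  have hexp : (fun n : ℕ => v (n + 1)) = T.expansion t := by
    rw [← htv]; funext n; rw [add_comm]
  have hval : value β (fun n : ℕ => v (n + 1)) = t := by rw [hexp, value_expansion ht]
  have hproj : proj₁ β (psi β v) = t := by
    rw [psi, hval, sub_eq_add_neg]
    exact proj₁_smul_add β t _ ((hyperplane β).neg_mem (phiSeq β fun n : ℕ => v (-n)).2)
  rw [Set.mem_preimage, hproj] at hy
  refine ⟨t, phiSeq β fun n : ℕ => v (-n), ?_, by rw [psi, hval]⟩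
  rw [← (hsub ⟨hy.1.le, hy.2⟩).2]
  exact ⟨v, hv, fun n => congrFun hexp n, rfl⟩

/-- The union `N` of the tiles without interior is closed and stable: subtiles of such a tile have
no interior, and translation preserves the prototile. So `N` is null, while every tile has positive
measure. -/
theorem interior_prototile_nonempty (hA : ∀ a ∈ T.A, a ∈ ringZ β)
    (hsupp : T.invMeasure.support = closure T.domain) (hV : T.V.Finite) {x : ℚ⟮β⟯}
    (hx : x ∈ T.tileIndex) : (interior (T.prototile (x : ℝ))).Nonempty := by
  by_contra hbad
  let ι := {x : T.tileIndex // ¬(interior (T.prototile ((x : ℚ⟮β⟯) : ℝ))).Nonempty}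
  set N : Set (hyperplane β) := ⋃ x : ι, T.tile (x : T.tileIndex) with hN
  have hlf : LocallyFinite fun x : ι => T.tile (x : T.tileIndex) :=
    (locallyFinite_tile T).comp_injective Subtype.val_injective
  have hcl : ∀ x : ι, IsClosed (T.tile (x : T.tileIndex)) := fun x => tile_isClosed x.1.2
  have hnull : volume N = 0 := by
    refine volume_eq_zero_of_translate (hlf.isClosed_iUnion hcl) ?_ ?_ ?_
    -- By Baire, countably many closed sets without interior cannot cover `H`.
    · intro huniv
      have : Countable ι := Set.countable_univ_iff.mp
        (hlf.countable_univ fun x => (prototile_nonempty x.1.2.2).image _)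
      obtain ⟨y, hy⟩ := nonempty_interior_of_iUnion_of_closed hcl huniv
      exact y.2 (interior_tile_nonempty.mp hy)
    · intro p hp
      obtain ⟨y, hy⟩ := Set.mem_iUnion.mp hp
      obtain ⟨y', hy', hnext, hmem⟩ := exists_next_eq hA y.1.2 hy
      refine Set.mem_iUnion.mpr ⟨⟨⟨y', hy'⟩, fun hint => y.2 ?_⟩, hmem⟩
      rw [← interior_tile_nonempty] at hint ⊢
      have hsub : mulHomeo (gen_ne_zero β) '' T.tile y' ⊆ T.tile (y : T.tileIndex) := by
        rintro _ ⟨q, hq, rfl⟩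
        rw [← hnext]
        exact mulMap_mem_tile hy' hq
      refine Set.Nonempty.mono (interior_mono hsub) ?_
      rw [← Homeomorph.image_interior]
      exact hint.image _
    · intro p r
      obtain ⟨ε, hε, h⟩ := exists_translate_tile hV p r
      refine ⟨ε, hε, fun z hz hzI q hq hmem => ?_⟩
      obtain ⟨y, hy⟩ := Set.mem_iUnion.mp hmem
      obtain ⟨h1, h2, h3⟩ := h z hz hzI q hq _ y.1.2 hy
      exact Set.mem_iUnion.mpr ⟨⟨⟨_, h1⟩, by
        rw [h3]; exact y.2⟩, h2⟩
  have htile : volume (T.tile x) = 0 :=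
    measure_mono_null (Set.subset_iUnion (fun x : ι => T.tile (x : T.tileIndex)) ⟨⟨x, hx⟩, hbad⟩)
      hnull
  refine volume_prototile_ne_zero hsupp hV hx.2 ?_
  rwa [tile, Set.image_add_left, measure_preimage_add] at htile

/-- Each point of a tile lies in subtiles `B^n 𝒯_y` of that tile; these have interior points and
their diameters tend to `0`. -/
theorem closure_interior_prototile (hA : ∀ a ∈ T.A, a ∈ ringZ β)
    (hsupp : T.invMeasure.support = closure T.domain) (hV : T.V.Finite) {x : ℚ⟮β⟯}
    (hx : x ∈ T.tileIndex) :
    closure (interior (T.prototile (x : ℝ))) = T.prototile (x : ℝ) := by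
  refine Set.Subset.antisymm
    (closure_minimal interior_subset (prototile_isCompact hx.2).isClosed) ?_
  let e := Homeomorph.addLeft (Phi β x)
  rw [← Set.image_subset_image_iff e.injective, e.image_closure, e.image_interior]
  change T.tile x ⊆ closure (interior (T.tile x))
  intro p hp
  rw [Metric.mem_closure_iff]
  intro ε hε
  obtain ⟨M, _, hM⟩ := T.exists_prototile_bound
  obtain ⟨C, hC0, hC⟩ := exists_norm_mulMap_pow_le β
  have htend := ((tendsto_pow_atTop_nhds_zero_of_lt_one (rate_pos (β := β)).le
    rate_lt_one).const_mul C).mul_const (M + M)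
  rw [mul_zero, zero_mul] at htend
  obtain ⟨n, hn⟩ := (htend.eventually (gt_mem_nhds hε)).exists
  obtain ⟨y, hy, q, hq, rfl, hsub⟩ := exists_subdivision hA n x hx p hp
  obtain ⟨c, hc⟩ := interior_tile_nonempty.mpr (interior_prototile_nonempty hA hsupp hV hy)
  let b := mulHomeo (pow_ne_zero n (gen_ne_zero β))
  have hint : b '' interior (T.tile y) ⊆ interior (T.tile x) := by
    rw [b.image_interior]
    refine interior_mono ?_
    rintro _ ⟨q', hq', rfl⟩
    exact hsub q' hq'
  refine ⟨_, hint ⟨c, hc, rfl⟩, ?_⟩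
  change dist (mulMap (gen β ^ n) q) (mulMap (gen β ^ n) c) < ε
  rw [dist_eq_norm, ← map_sub]
  refine (hC n _).trans_lt (lt_of_le_of_lt ?_ hn)
  have h1 := hM _ hy.2 _ (mem_tile.mp hq)
  have h2 := hM _ hy.2 _ (mem_tile.mp (interior_subset hc))
  have h3 := (norm_sub_le _ _).trans (add_le_add h1 h2)
  rw [sub_sub_sub_cancel_right] at h3
  have := mul_nonneg hC0 (pow_nonneg (rate_pos (β := β)).le n)
  gcongr

/-- Let `m` be the least covering number. The set where it exceeds `m` is closed since the number is
upper semicontinuous. The number does not decrease under `B⁻¹`, as `next` maps the tiles at `B⁻¹ p`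
onto those at `p`, nor under backward translation, as `x ↦ x - z` is injective. So the set is null.
-/
theorem exists_covering_degree (hA : ∀ a ∈ T.A, a ∈ ringZ β) (hV : T.V.Finite) :
    ∃ m : ℕ, 1 ≤ m ∧ ∀ᵐ y ∂(volume : Measure (hyperplane β)),
      {x : T.tileIndex | y ∈ T.tile x}.encard = m := by
  set f : hyperplane β → Set ℚ⟮β⟯ := fun p => {x | x ∈ T.tileIndex ∧ p ∈ T.tile x} with hf
  have hfin : ∀ p, (f p).Finite := fun p =>
    (finite_tiles_near T p 0).subset fun x hx => ⟨hx.1, p, hx.2, by simp⟩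
  obtain ⟨p₀, hp₀⟩ : ∃ p₀, ∀ p, (f p₀).ncard ≤ (f p).ncard :=
    ⟨Function.argmin fun p => (f p).ncard, fun p => Function.argmin_le (fun p => (f p).ncard) p⟩
  set m := (f p₀).ncard with hm
  have hm1 : 1 ≤ m := by
    obtain ⟨x, hx⟩ := exists_mem_tile hA p₀
    exact (Set.ncard_pos (hfin p₀)).mpr ⟨x, x.2, hx⟩
  have hnull : volume {p | m < (f p).ncard} = 0 := by
    refine volume_eq_zero_of_translate ?_ ?_ ?_ ?_
    · rw [← isOpen_compl_iff, isOpen_iff_mem_nhds]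
      intro p hp
      filter_upwards [(locallyFinite_tile T).eventually_subset (fun x => tile_isClosed x.2) p]
        with q hq hc
      refine hp (lt_of_lt_of_le (Set.mem_ofPred_eq.mp hc) (Set.ncard_le_ncard ?_ (hfin p)))
      exact fun x hx => ⟨hx.1, hq (show (⟨x, hx.1⟩ : T.tileIndex) ∈ _ from hx.2)⟩
    · exact (Set.ne_univ_iff_exists_notMem _).mpr ⟨p₀, lt_irrefl m⟩
    · intro p hp
      refine lt_of_lt_of_le (Set.mem_ofPred_eq.mp hp) ?_
      refine (Set.ncard_le_ncard (t := T.next '' f (mulMap (gen β)⁻¹ p)) ?_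
        ((hfin _).image _)).trans (Set.ncard_image_le (hfin _))
      rintro x ⟨hx, hpx⟩
      obtain ⟨y, hy, hnext, hmem⟩ := exists_next_eq hA hx hpx
      exact ⟨y, ⟨hy, hmem⟩, hnext⟩
    · intro p r
      obtain ⟨ε, hε, h⟩ := exists_translate_tile hV p r
      refine ⟨ε, hε, fun z hz hzI q hq hlt => lt_of_lt_of_le (Set.mem_ofPred_eq.mp hlt) ?_⟩
      have h' := h z hz hzI q hq
      exact Set.ncard_le_ncard_of_injOn (fun x => x - z)
        (fun x hx => ⟨(h' x hx.1 hx.2).1, (h' x hx.1 hx.2).2.1⟩) sub_left_injective.injOn (hfin _)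
  refine ⟨m, hm1, ?_⟩
  rw [ae_iff]
  refine measure_mono_null (fun p hp => ?_) hnull
  refine lt_of_le_of_ne (hp₀ p) fun he => hp ?_
  have himg : Subtype.val '' {x : T.tileIndex | p ∈ T.tile x} = f p := by
    ext x
    exact ⟨by rintro ⟨x, hx, rfl⟩; exact ⟨x.2, hx⟩, fun hx => ⟨⟨x, hx.1⟩, hx.2, rfl⟩⟩
  rw [← Subtype.val_injective.encard_image, himg, ← (hfin p).cast_ncard_eq, ← he]

end Measure

end Transf

end

end BetaTiling

theorem theoremt (β : ℝ) [BetaTiling.IsPisotUnit β] (T : BetaTiling.Transf β)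
    (hA : ∀ a ∈ T.A, a ∈ BetaTiling.ringZ β)
    (hsupp : T.invMeasure.support = closure T.domain)
    (hV : T.V.Finite) :
    BetaTiling.IsMultipleTiling
      (fun x : T.tileIndex => BetaTiling.Phi β x)
      (fun x : T.tileIndex => T.prototile (x : ℝ)) where
  finite_prototiles := by
    refine (BetaTiling.Transf.finite_prototiles hV).subset ?_
    rintro _ ⟨x, rfl⟩
    exact ⟨_, x.2.2, rfl⟩
  isCompact x := BetaTiling.Transf.prototile_isCompact x.2.2
  locallyFinite y := by
    refine ⟨1, one_pos, ?_⟩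
    refine Set.Finite.of_finite_image ((BetaTiling.Transf.finite_tiles_near T y 1).subset ?_)
      Subtype.val_injective.injOn
    rintro _ ⟨x, ⟨q, hq, hqy⟩, rfl⟩
    exact ⟨x.2, q, hq, by rw [← dist_eq_norm]; exact (Metric.mem_ball.mp hqy).le⟩
  covers := BetaTiling.Transf.exists_mem_tile hA
  closure_interior x := BetaTiling.Transf.closure_interior_prototile hA hsupp hV x.2
  exists_degree := BetaTiling.Transf.exists_covering_degree hA hV
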